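/- For $n\ge 1$ let $V_n=\mathbf P^1-\{0,\mu_n,\infty\}$ (complex points) and $\zeta_n=e^{2\pi i/n}$. Let $\mathsf M_n$ be the set of words in the letters $X_n$ and $Y_{i,n}$ $(0\le i<n)$, to which we attach the forms $\omega_{X_n}=\frac{dz}{z}$ and $\omega_{Y_{i,n}}=\frac{dz}{z-\zeta_n^i}$. The number of letters $X_n$ in a word $w$ is its $X$-weight $\mathsf{wt}_X(w)$. For $u\in\mathsf M_{rn}$ and $w\in\mathsf M_r$ we write $u\equiv w \bmod r$ if replacing in $u$ each $X_{rn}$ by $X_r$, and each $Y_{j,rn}$ by $Y_{i,r}$ with $0\le i<r$, $i\equiv j \bmod r$, gives $w$. A path on $V_n$ from the tangential base point $\overrightarrow{01}$ to $z\in V_n$ is a continuous $\gamma:[0,1]\to\mathbf C$ with $\gamma(0)=0$, $\gamma(1)=z$, $\gamma(t)\in V_n$ for $0<t\le1$, which is piecewise $C^1$ on $(0,1]$ and leaves $0$ in the direction of the positive real axis, i.e. $\gamma(t)/|\gamma(t)|\to1$ as $t\to0^+$. For $0<s<1$ let $$\Lambda_s(\gamma)=\sum_{w=a_1\cdots a_k\in\mathsf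 M_n}\Bigl(\int_{s\le t_1\le\cdots\le t_k\le 1}\gamma^*\omega_{a_1}(t_1)\cdots\gamma^*\omega_{a_k}(t_k)\Bigr)\,w\in\mathbf C\langle\langle X_n,Y_{i,n}\rangle\rangle,$$ and define the iterated integral $\mathsf{Li}_w(\overrightarrow{01}\overset{\gamma}{\rightsquigarrow}z)$ along $\gamma$ to be the coefficient of $w$ in $\lim_{s\to0^+}\exp(\log\gamma(s)\,X_n)\,\Lambda_s(\gamma)$ ($\log$ is the principal branch). **Theorem.** (a) Let $n,r\ge1$ and let $\gamma$ be a path on $V_{rn}$ from $\overrightarrow{01}$ to $z$. Then $\pi_{rn,r}(\gamma):t\mapsto\gamma(t)^n$ is a path on $V_r$ from $\overrightarrow{01}$ to $z^n$, all limits that define the iterated integrals along $\gamma$ and along $\pi_{rn,r}(\gamma)$ exist, and for every $w\in\mathsf M_r$ $$\mathsf{Li}_w(\overrightarrow{01}\overset{\pi_{rn,r}(\gamma)}{\rightsquigarrow}z^n)=n^{\mathsf{wt}_X(w)}\sum_{\substack{u\in\mathsf M_{rn}\\ u\equiv w\bmod r}}\mathsf{Li}_u(\overrightarrow{01}\overset{\gamma}{\rightsquigarrow}z).$$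 (b) (Kubert identity.) For a path $\gamma$ on $V_1$ from $\overrightarrow{01}$ to $z$ and $k\ge1$ put $Li_k(z)_\gamma=-\mathsf{Li}_{YX^{k-1}}(\overrightarrow{01}\overset{\gamma}{\rightsquigarrow}z)$, where $X=X_1$, $Y=Y_{0,1}$. Let $\gamma$ be a path on $V_n$ from $\overrightarrow{01}$ to $z$. For $\zeta=\zeta_n^s$, $0\le s<n$, let $\delta_\zeta\cdot\jmath_\zeta(\gamma)$ be the path on $V_1$ from $\overrightarrow{01}$ to $\zeta z$ that consists of the anti-clockwise arc about $0$ of angle $2\pi s/n$ from $\overrightarrow{01}$ to $\zeta\overrightarrow{01}$, followed by $\zeta\gamma$; explicitly, it is $t\mapsto e^{\frac{2\pi i s}{n}\min(1,t/\delta)}\gamma(t)$, for any $0<\delta\le1$ such that $|\gamma(t)|<1$ for $0<t\le\delta$. Then, for every $k\ge1$, the limits that define the following terms exist, and $$Li_k(z^n)_{\pi_{n,1}(\gamma)}=n^{k-1}\sum_{\zeta\in\mu_n}Li_k(\zeta z)_{\delta_\zeta\cdot\jmath_\zeta(\gamma)}.$$ -/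

import Mathlib

open Filter Topology Set

noncomputable section

/-- The primitive root of unity `exp (2 π i / n)`. -/
def zetaRoot (n : ℕ) : ℂ := Complex.exp (2 * Real.pi * Complex.I / n)

/-- The complex points of `P¹ ∖ {0, μ_n, ∞}`. -/
def curveV (n : ℕ) : Set ℂ := {z | z ≠ 0 ∧ z ^ n ≠ 1}

/-- The letters `X_n` and `Y_{i,n}` for `0 ≤ i < n`. -/
inductive Letter (n : ℕ) : Type
  | X : Letter n
  | Y (i : Fin n) : Letter n
  deriving DecidableEq

/-- Words (non-commutative monomials) in the letters `X_n`, `Y_{i,n}`. -/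
abbrev Word (n : ℕ) : Type := List (Letter n)

/-- The `X`-weight of a word: the number of its letters equal to `X_n`. -/
def wtX {n : ℕ} (w : Word n) : ℕ := w.count Letter.X

/-- Reduction of a letter modulo `r`: `X_m ↦ X_r` and `Y_{j,m} ↦ Y_{i,r}`, where
`0 ≤ i < r` and `i ≡ j mod r`. -/
def Letter.modulo (r : ℕ) [NeZero r] {m : ℕ} : Letter m → Letter r
  | .X => .X
  | .Y j => .Y ⟨(j : ℕ) % r, Nat.mod_lt _ (NeZero.pos r)⟩

/-- Congruence modulo `r` of words in possibly different alphabets (meant for `r` a common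
divisor of `m` and `m'`). -/
def CongrMod (r : ℕ) [NeZero r] {m m' : ℕ} (u : Word m) (w : Word m') : Prop :=
  u.map (Letter.modulo r) = w.map (Letter.modulo r)

instance (n : ℕ) : Finite (Letter n) :=
  Finite.of_surjective
    (fun o : Option (Fin n) => (o.elim Letter.X Letter.Y : Letter n))
    (fun a => by
      cases a with
      | X => exact ⟨none, rfl⟩
      | Y i => exact ⟨some i, rfl⟩)

theorem finite_congrMod (r : ℕ) [NeZero r] (m : ℕ) {m' : ℕ} (w : Word m') :
    {u : Word m | CongrMod r u w}.Finite := by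
  refine (List.finite_length_eq (Letter m) w.length).subset ?_
  intro u hu
  have h := congrArg List.length hu
  simpa using h

/-- The finite set of the words `u` in the letters `X_m`, `Y_{j,m}` with `u ≡ w mod r`. -/
def congrWords (r : ℕ) [NeZero r] (m : ℕ) {m' : ℕ} (w : Word m') : Finset (Word m) :=
  (finite_congrMod r m w).toFinset

/-- The coefficient functions of the logarithmic forms: `dz/z` for `X_n`, and
`dz/(z - ζ_n^i)` for `Y_{i,n}`. -/
def logForm {n : ℕ} : Letter n → ℂ → ℂ
  | .X, z => 1 / z
  | .Y i, z => 1 / (z - zetaRoot n ^ (i : ℕ))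

/-- Non-commutative formal power series over `ℂ` in `X_n`, `Y_{i,n}`, given by coefficients. -/
abbrev NCSeries (n : ℕ) : Type := Word n → ℂ

/-- The product of non-commutative power series. -/
def NCSeries.mul {n : ℕ} (F G : NCSeries n) : NCSeries n :=
  fun w => ∑ k ∈ Finset.range (w.length + 1), F (w.take k) * G (w.drop k)

/-- The power series `exp (c X_n)`. -/
def NCSeries.expX (n : ℕ) (c : ℂ) : NCSeries n :=
  fun w => if w = List.replicate w.length Letter.X then c ^ w.length / (w.length.factorial : ℂ)
    else 0

/-- Iterated integrals along `γ` restricted to `[s, t]`, with the word read backwards: the head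
of the list is the form that is integrated last. -/
def iterIntRev {n : ℕ} (γ : ℝ → ℂ) (s : ℝ) : List (Letter n) → ℝ → ℂ
  | [], _ => 1
  | a :: v, t => ∫ τ in s..t, iterIntRev γ s v τ * (logForm a (γ τ) * deriv γ τ)

/-- The series `Λ` of the restriction of `γ` to `[s, t]`: its coefficient at a word
`a₁ a₂ ⋯ a_k` is the iterated integral `∫ ω_{a₁} ω_{a₂} ⋯ ω_{a_k}` over
`s ≤ t₁ ≤ t₂ ≤ ⋯ ≤ t_k ≤ t`. As a function of `t` this is the solution of `dΦ = Φ ω` along `γ`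
with value `1` at `t = s`, where `ω` is the sum of (form) · (letter). -/
def Lambda (n : ℕ) (γ : ℝ → ℂ) (s t : ℝ) : NCSeries n :=
  fun w => iterIntRev γ s w.reverse t

/-- `γ`, restricted to `[0, 1]`, is a path on `P¹ ∖ {0, μ_n, ∞}` from the tangential base point
`01→` (the unit tangent vector at `0`) to `z`: it leaves `0` in the direction of the positive real
axis, stays in the curve for `0 < t ≤ 1`, ends at `z`, and is piecewise continuously
differentiable on `(0, 1]` with finitely many break points. Only the direction at `0` is
prescribed, not the speed, so that paths with `γ'(0) = 1` and their images under `z ↦ z ^ n` are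
included. -/
structure IsTangentialPath (n : ℕ) (γ : ℝ → ℂ) (z : ℂ) : Prop where
  continuousOn : ContinuousOn γ (Icc 0 1)
  map_zero : γ 0 = 0
  map_one : γ 1 = z
  mem_curve : ∀ t ∈ Ioc (0 : ℝ) 1, γ t ∈ curveV n
  direction : Tendsto (fun t => γ t / (‖γ t‖ : ℂ)) (𝓝[>] 0) (𝓝 1)
  piecewise : ∃ S : Finset ℝ, ∀ a b : ℝ, 0 < a → a < b → b ≤ 1 →
    (∀ t ∈ Ioo a b, t ∉ S) → ContDiffOn ℝ 1 γ (Icc a b)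

/-- The series `exp (log γ(s) · X_n) · Λ(γ restricted to [s, 1])`. Its limit as `s → 0⁺` is the
series of the path `γ` from the tangential base point `01→`; the principal branch of the
logarithm is the right one, since `γ(s)` has argument close to `0` for small `s`. -/
def regLambda (n : ℕ) (γ : ℝ → ℂ) (s : ℝ) : NCSeries n :=
  NCSeries.mul (NCSeries.expX n (Complex.log (γ s))) (Lambda n γ s 1)

/-- The iterated integral `Li_w` along the path `γ` from the tangential base point `01→`: the
coefficient at `w` of the regularized series. -/
def LiWord (n : ℕ) (γ : ℝ → ℂ) (w : Word n) : ℂ :=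
  limUnder (𝓝[>] (0 : ℝ)) (fun s => regLambda n γ s w)

/-- The limit which defines `LiWord n γ w` exists. -/
def LiConverges (n : ℕ) (γ : ℝ → ℂ) (w : Word n) : Prop :=
  Tendsto (fun s => regLambda n γ s w) (𝓝[>] (0 : ℝ)) (𝓝 (LiWord n γ w))

/-- The word `Y X^{k-1}` in the letters `X = X_1` and `Y = Y_{0,1}`. -/
def polylogWord (k : ℕ) : Word 1 := Letter.Y 0 :: List.replicate (k - 1) Letter.X

/-- The classical polylogarithm `Li_k` along a path `γ` from `01→`, as the iterated integral of
`dz/(1-z)` followed by `k - 1` times `dz/z`. -/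
def polylogAlong (k : ℕ) (γ : ℝ → ℂ) : ℂ := -LiWord 1 γ (polylogWord k)

/-- For a path `γ` from `01→` whose initial part `0 < t ≤ δ` lies in the open unit disc, and for
`ζ = exp (i α)` with `α ≥ 0`: the path composed of the anti-clockwise arc of angle `α` around `0`
from `01→` to `ζ 01→`, and the path `ζ γ`. The arc is run through inside the punctured unit disc
while `0 < t ≤ δ`. -/
def arcThenRotate (α δ : ℝ) (γ : ℝ → ℂ) : ℝ → ℂ :=
  fun t => Complex.exp (Complex.I * ((α * min 1 (t / δ) : ℝ) : ℂ)) * γ t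

end

/-! Iterated integrals are the coefficients of solutions of `dL = L ω`, with `ω` the sum of (form) ·
(letter). On the universal cover of the punctured unit disc, with coordinate `l = log z` in the
half-plane `Re l < 0`, there is a solution `asympSol` that differs from `exp (l X)` by terms `l ^ k
* f (exp l)` with `f 0 = 0`. These beat every power of `l` as `Re l → -∞` with `Im l` convergent.

If `l` is a logarithm of `γ` that is principal near `0`, then `asympSol (l s) · Λ(s, 1)` does not
depend on `s` (`IsLogLift.mul_Lambda_eq`). It follows that `Λ(s, 1)` grows at most like a power of
`l s`, so that replacing `asympSol (l s)` by `exp (log γ(s) X)` costs nothing in the limit. Hence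
every regularized integral exists and equals a coefficient of `asympSol (l δ) · Λ(δ, 1)`.

For (a), pulling back `ω` under `z ↦ z ^ n` multiplies `dz/z` by `n` and splits `dz/(z - ζ_r^i)`
into the sum of the `dz/(z - ζ_{rn}^j)` with `j ≡ i mod r`. The dual operation `pushSeries` on
series is multiplicative and carries `exp (c X)` to `exp (n c X)` and `Λ` of `γ` to `Λ` of `γ ^ n`.
So the identity holds before the limit, for all small `s`.

For (b), take `r = 1` and the word `Y X^{k-1}` in (a). The terms on the right are integrals of `Y_i
X^{k-1}` along `γ`, and the rotation `z ↦ ζ z` with `ζ ζ_n^i = 1` identifies them with integrals of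
`Y X^{k-1}` along the rotated paths. The arc shifts `l` by an imaginary constant, which is invisible
to words that begin with `Y`, because their coefficient in `exp (l X)` is zero. -/

/-! ### Logarithmic functions that are negligible at the puncture -/

/-- Finite sums of functions `l ^ k * f (exp l)`, where `f` is holomorphic on the unit disc and
vanishes at `0`. -/
def logSpan : Submodule ℂ (ℂ → ℂ) :=
  Submodule.span ℂ {F | ∃ (k : ℕ) (f : ℂ → ℂ), DifferentiableOn ℂ f (Metric.ball 0 1) ∧ f 0 = 0 ∧
    F = fun l => l ^ k * f (Complex.exp l)}

theorem mem_logSpan_of_differentiableOn (k : ℕ) {f : ℂ → ℂ}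
    (hf : DifferentiableOn ℂ f (Metric.ball 0 1)) (h0 : f 0 = 0) :
    (fun l => l ^ k * f (Complex.exp l)) ∈ logSpan :=
  Submodule.subset_span ⟨k, f, hf, h0, rfl⟩

theorem exp_mem_ball {l : ℂ} (hl : l.re < 0) : Complex.exp l ∈ Metric.ball (0 : ℂ) 1 := by
  simpa [Complex.norm_exp] using hl

theorem tendsto_pow_mul_exp {ι : Type*} {u : Filter ι} {l : ι → ℂ} {c : ℝ}
    (hre : Tendsto (fun i => (l i).re) u atBot) (him : Tendsto (fun i => (l i).im) u (𝓝 c))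
    (N : ℕ) : Tendsto (fun i => l i ^ N * Complex.exp (l i)) u (𝓝 0) := by
  -- The factor `2` comes from `‖l‖ ≤ |Re l| + |Im l| ≤ 2 |Re l|`, valid once `-Re l ≥ |c| + 1 > |Im
  -- l|`.
  have h1 : Tendsto (fun i => (2 : ℝ) ^ N * ((-(l i).re) ^ N * Real.exp (-(-(l i).re)))) u (𝓝 0) := by
    have := ((Real.tendsto_pow_mul_exp_neg_atTop_nhds_zero N).comp
      (tendsto_neg_atBot_atTop.comp hre)).const_mul ((2 : ℝ) ^ N)
    simpa [Function.comp_def] using this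
  refine squeeze_zero_norm' ?_ h1
  have h2 : ∀ᶠ i in u, |(l i).im| < |c| + 1 :=
    him.abs.eventually (gt_mem_nhds (lt_add_one _))
  filter_upwards [h2, hre.eventually (eventually_le_atBot (-(|c| + 1)))] with i hi hi'
  rw [norm_mul, norm_pow, Complex.norm_exp, neg_neg, ← mul_assoc, ← mul_pow]
  gcongr
  have := Complex.norm_le_abs_re_add_abs_im (l i)
  have hneg : |(l i).re| = -(l i).re := abs_of_nonpos (by have := abs_nonneg c; linarith)
  linarith

theorem tendsto_pow_mul_of_mem_logSpan {F : ℂ → ℂ} (hF : F ∈ logSpan) {ι : Type*} {u : Filter ι}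
    {l : ι → ℂ} {c : ℝ} (hre : Tendsto (fun i => (l i).re) u atBot)
    (him : Tendsto (fun i => (l i).im) u (𝓝 c)) (N : ℕ) :
    Tendsto (fun i => l i ^ N * F (l i)) u (𝓝 0) := by
  induction hF using Submodule.span_induction with
  | mem F hF =>
    obtain ⟨k, f, hf, h0, rfl⟩ := hF
    have hO : f =O[𝓝 0] fun z => z := by
      have := (hf.differentiableAt (Metric.ball_mem_nhds 0 one_pos)).isBigO_sub
      simpa [h0] using this
    have h1 := hO.comp_tendsto (Complex.tendsto_exp_nhds_zero_iff.mpr hre)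
    have h2 := (Asymptotics.isBigO_refl (fun i => l i ^ (N + k)) u).mul h1
    have h3 := h2.trans_tendsto (tendsto_pow_mul_exp hre him (N + k))
    refine h3.congr fun i => ?_
    simp only [Function.comp_apply]; ring
  | zero => simp [tendsto_const_nhds]
  | add F G _ _ h1 h2 => simpa [mul_add] using h1.add h2
  | smul a F _ h =>
    have := h.const_mul a
    simp only [mul_zero] at this
    refine this.congr fun i => ?_
    simp only [Pi.smul_apply, smul_eq_mul]; ring

/-- Since `f 0 = 0`, the quotient `f z / z` is holomorphic on the disc and has a primitive `g` with
`g 0 = 0`; then `g (exp l)` has derivative `f (exp l)`. For `l ^ (k + 1) * f (exp l)` integrate by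
parts: `l ^ (k + 1) * g (exp l)` leaves the error `(k + 1) * l ^ k * g (exp l)`, which has a lower
power of `l`. -/
theorem exists_primitive_of_mem_logSpan {F : ℂ → ℂ} (hF : F ∈ logSpan) :
    ∃ G ∈ logSpan, ∀ l : ℂ, l.re < 0 → HasDerivAt G (F l) l := by
  induction hF using Submodule.span_induction with
  | mem F hF =>
    obtain ⟨k, f, hf, h0, rfl⟩ := hF
    induction k generalizing f with
    | zero =>
      have hd := (Complex.differentiableOn_dslope (Metric.ball_mem_nhds (0 : ℂ) one_pos)).mpr hf
      obtain ⟨g, hg0, hg⟩ := hd.isExactOn_ball.with_val_at 0 0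
      refine ⟨_, mem_logSpan_of_differentiableOn 0
        (fun z hz => (hg z hz).differentiableAt.differentiableWithinAt) hg0, fun l hl => ?_⟩
      have := (hg _ (exp_mem_ball hl)).comp l (Complex.hasDerivAt_exp l)
      rw [dslope_of_ne _ (Complex.exp_ne_zero l), slope_def_field, h0, sub_zero, sub_zero,
        div_mul_cancel₀ _ (Complex.exp_ne_zero l)] at this
      simpa [Function.comp_def] using this
    | succ k ih =>
      have hd := (Complex.differentiableOn_dslope (Metric.ball_mem_nhds (0 : ℂ) one_pos)).mpr hf
      obtain ⟨g, hg0, hg⟩ := hd.isExactOn_ball.with_val_at 0 0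
      have hgd : DifferentiableOn ℂ g (Metric.ball 0 1) :=
        fun z hz => (hg z hz).differentiableAt.differentiableWithinAt
      obtain ⟨G, hG, hG'⟩ := ih g hgd hg0
      refine ⟨_, logSpan.sub_mem (mem_logSpan_of_differentiableOn (k + 1) hgd hg0)
        (logSpan.smul_mem ((k : ℂ) + 1) hG), fun l hl => ?_⟩
      have h1 := (hg _ (exp_mem_ball hl)).comp l (Complex.hasDerivAt_exp l)
      rw [dslope_of_ne _ (Complex.exp_ne_zero l), slope_def_field, h0, sub_zero, sub_zero,
        div_mul_cancel₀ _ (Complex.exp_ne_zero l)] at h1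
      have h2 := ((hasDerivAt_pow (k + 1) l).mul h1).sub ((hG' l hl).const_mul ((k : ℂ) + 1))
      refine h2.congr_deriv ?_
      simp only [Function.comp_apply, Nat.cast_add, Nat.cast_one, Nat.add_sub_cancel]
      ring
  | zero => exact ⟨0, logSpan.zero_mem, fun l _ => hasDerivAt_const l 0⟩
  | add F G _ _ h1 h2 =>
    obtain ⟨A, hA, hA'⟩ := h1
    obtain ⟨B, hB, hB'⟩ := h2
    exact ⟨A + B, logSpan.add_mem hA hB, fun l hl => (hA' l hl).add (hB' l hl)⟩
  | smul a F _ h =>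
    obtain ⟨A, hA, hA'⟩ := h
    exact ⟨a • A, logSpan.smul_mem a hA, fun l hl => (hA' l hl).const_smul a⟩

theorem pow_mul_mem_logSpan {g : ℂ → ℂ} (hg : DifferentiableOn ℂ g (Metric.ball 0 1))
    {F : ℂ → ℂ} (hF : F ∈ logSpan) : (fun l => F l * g (Complex.exp l)) ∈ logSpan := by
  induction hF using Submodule.span_induction with
  | mem F hF =>
    obtain ⟨k, f, hf, h0, rfl⟩ := hF
    have := mem_logSpan_of_differentiableOn k (hf.mul hg) (by simp [h0])
    simpa [mul_assoc] using this
  | zero =>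
    convert logSpan.zero_mem using 1
    ext l
    simp
  | add F G _ _ h1 h2 => simpa [add_mul, Pi.add_def] using logSpan.add_mem h1 h2
  | smul a F _ h => simpa [mul_assoc, Pi.smul_def] using logSpan.smul_mem a h

/-! ### The solution asymptotic to `exp (l X)` -/

theorem norm_zetaRoot (n : ℕ) : ‖zetaRoot n‖ = 1 := by
  rw [zetaRoot, show (2 * Real.pi * Complex.I / n : ℂ) = ((2 * Real.pi / n : ℝ) : ℂ) * Complex.I by
    push_cast; ring]
  exact Complex.norm_exp_ofReal_mul_I _

theorem differentiableOn_logForm_Y_mul {n : ℕ} (i : Fin n) :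
    DifferentiableOn ℂ (fun z => logForm (Letter.Y i) z * z) (Metric.ball 0 1) := by
  simp only [logForm]
  refine DifferentiableOn.mul (DifferentiableOn.div (by fun_prop) (by fun_prop) ?_) (by fun_prop)
  intro z hz h
  rw [sub_eq_zero] at h
  rw [h] at hz
  simp [norm_zetaRoot] at hz

theorem expX_nil (n : ℕ) (c : ℂ) : NCSeries.expX n c [] = 1 := by simp [NCSeries.expX]

theorem append_singleton_eq_replicate {n : ℕ} (w : Word n) (a : Letter n) :
    w ++ [a] = List.replicate (w ++ [a]).length Letter.X ↔
      w = List.replicate w.length Letter.X ∧ a = Letter.X := by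
  rw [List.eq_replicate_iff, List.eq_replicate_iff]
  simp only [List.mem_append, List.mem_singleton, true_and]
  constructor
  · intro h
    exact ⟨fun b hb => h b (Or.inl hb), h a (Or.inr rfl)⟩
  · rintro ⟨h, rfl⟩ b (hb | rfl)
    · exact h b hb
    · rfl

theorem expX_append_Y {n : ℕ} (c : ℂ) (w : Word n) (i : Fin n) :
    NCSeries.expX n c (w ++ [Letter.Y i]) = 0 := by
  rw [NCSeries.expX, if_neg]
  rw [append_singleton_eq_replicate]
  simp

theorem hasDerivAt_expX_append_X {n : ℕ} (w : Word n) (l : ℂ) :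
    HasDerivAt (fun l => NCSeries.expX n l (w ++ [Letter.X])) (NCSeries.expX n l w) l := by
  simp only [NCSeries.expX, append_singleton_eq_replicate, and_true]
  split_ifs with h
  · rw [List.length_append, List.length_singleton]
    refine ((hasDerivAt_pow (w.length + 1) l).div_const _).congr_deriv ?_
    rw [Nat.factorial_succ, Nat.add_sub_cancel]
    have : ((w.length.factorial : ℕ) : ℂ) ≠ 0 := by exact_mod_cast Nat.factorial_ne_zero _
    have : ((w.length + 1 : ℕ) : ℂ) ≠ 0 := Nat.cast_ne_zero.mpr (Nat.succ_ne_zero _)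
    push_cast at *
    field_simp
  · exact hasDerivAt_const l 0

theorem expX_mul_mem_logSpan {n : ℕ} (w : Word n) {g : ℂ → ℂ}
    (hg : DifferentiableOn ℂ g (Metric.ball 0 1)) (h0 : g 0 = 0) :
    (fun l => NCSeries.expX n l w * g (Complex.exp l)) ∈ logSpan := by
  simp only [NCSeries.expX]
  split_ifs with h
  · have := logSpan.smul_mem ((w.length.factorial : ℂ)⁻¹)
      (mem_logSpan_of_differentiableOn w.length hg h0)
    convert this using 1
    ext l
    simp only [Pi.smul_apply, smul_eq_mul]
    ring
  · convert logSpan.zero_mem using 1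
    ext l
    simp

/-- In the coordinate `l` the form of `X` is `dl`, and `exp (l X)` already solves that part of the
equation. The form of `Y_i` is `dl` times a function of `exp l` that vanishes at `exp l = 0`, so
even its product with the polynomial coefficients of `exp (l X)` lies in `logSpan`. In both cases
only a primitive within `logSpan` is needed. -/
theorem exists_regPart_step {n : ℕ} (w : Word n) (a : Letter n) {R : ℂ → ℂ} (hR : R ∈ logSpan) :
    ∃ R' ∈ logSpan, ∀ l : ℂ, l.re < 0 →
      HasDerivAt (fun l => NCSeries.expX n l (w ++ [a]) + R' l)
        ((NCSeries.expX n l w + R l) * (logForm a (Complex.exp l) * Complex.exp l)) l := by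
  cases a with
  | X =>
    obtain ⟨G, hG, hG'⟩ := exists_primitive_of_mem_logSpan hR
    refine ⟨G, hG, fun l hl => ?_⟩
    refine ((hasDerivAt_expX_append_X w l).add (hG' l hl)).congr_deriv ?_
    rw [logForm, one_div, inv_mul_cancel₀ (Complex.exp_ne_zero l), mul_one]
  | Y i =>
    have hg := differentiableOn_logForm_Y_mul i
    obtain ⟨G, hG, hG'⟩ := exists_primitive_of_mem_logSpan
      (logSpan.add_mem (expX_mul_mem_logSpan w hg (mul_zero _)) (pow_mul_mem_logSpan hg hR))
    refine ⟨G, hG, fun l hl => ?_⟩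
    simp only [expX_append_Y, zero_add]
    refine (hG' l hl).congr_deriv ?_
    simp only [Pi.add_apply]
    ring

/-- The coefficient at `w` of the solution of `dL = L ω` on the universal cover of the punctured
unit disc which is asymptotic to `exp (l X)`, minus its coefficient in `exp (l X)`. -/
noncomputable def regPart (n : ℕ) (w : Word n) : logSpan :=
  List.reverseRecOn w 0 fun w a R =>
    ⟨(exists_regPart_step w a R.2).choose, (exists_regPart_step w a R.2).choose_spec.1⟩

/-- The solution of `dL = L ω` on the universal cover of the punctured unit disc which is
asymptotic to `exp (l X)` at `0`, where `l` is the logarithm of the coordinate. -/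
noncomputable def asympSol (n : ℕ) (l : ℂ) : NCSeries n :=
  fun w => NCSeries.expX n l w + (regPart n w : ℂ → ℂ) l

theorem asympSol_nil (n : ℕ) (l : ℂ) : asympSol n l [] = 1 := by
  simp [asympSol, expX_nil, regPart]

theorem regPart_append (n : ℕ) (w : Word n) (a : Letter n) :
    (regPart n (w ++ [a]) : ℂ → ℂ) = (exists_regPart_step w a (regPart n w).2).choose := by
  rw [regPart, List.reverseRecOn_concat]
  rfl

theorem hasDerivAt_asympSol {n : ℕ} (w : Word n) (a : Letter n) {l : ℂ} (hl : l.re < 0) :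
    HasDerivAt (fun l => asympSol n l (w ++ [a]))
      (asympSol n l w * (logForm a (Complex.exp l) * Complex.exp l)) l := by
  have := (exists_regPart_step w a (regPart n w).2).choose_spec.2 l hl
  simp only [asympSol]
  rw [regPart_append]
  exact this

/-! ### Forms and derivatives along piecewise smooth paths -/

theorem isPrimitiveRoot_zetaRoot (n : ℕ) [NeZero n] : IsPrimitiveRoot (zetaRoot n) n :=
  Complex.isPrimitiveRoot_exp n (NeZero.ne n)

theorem zetaRoot_pow_self (n : ℕ) [NeZero n] : zetaRoot n ^ n = 1 :=
  (isPrimitiveRoot_zetaRoot n).pow_eq_one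

theorem sub_zetaRoot_pow_ne_zero {n : ℕ} [NeZero n] {z : ℂ} (hz : z ∈ curveV n) (i : ℕ) :
    z - zetaRoot n ^ i ≠ 0 := by
  intro h
  apply hz.2
  rw [sub_eq_zero.mp h, ← pow_mul, mul_comm, pow_mul, zetaRoot_pow_self, one_pow]

theorem continuousAt_logForm {n : ℕ} (a : Letter n) {z : ℂ} (hz : z ∈ curveV n) :
    ContinuousAt (logForm a) z := by
  cases a with
  | X => exact continuousAt_const.div continuousAt_id hz.1
  | Y i =>
    have : NeZero n := ⟨by rintro rfl; exact i.elim0⟩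
    exact continuousAt_const.div (by fun_prop) (sub_zetaRoot_pow_ne_zero hz i)

/-- `S` contains the break points of `γ` on `(0, 1]`. -/
def IsBreakSet (γ : ℝ → ℂ) (S : Finset ℝ) : Prop :=
  ∀ a b : ℝ, 0 < a → a < b → b ≤ 1 → (∀ t ∈ Ioo a b, t ∉ S) → ContDiffOn ℝ 1 γ (Icc a b)

theorem IsBreakSet.contDiffAt {γ : ℝ → ℂ} {S : Finset ℝ} (h : IsBreakSet γ S) {t : ℝ}
    (ht : t ∈ Ioo (0 : ℝ) 1) (hS : t ∉ S) : ContDiffAt ℝ 1 γ t := by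
  have hU : Ioo (0 : ℝ) 1 \ S ∈ 𝓝 t :=
    (isOpen_Ioo.sdiff S.finite_toSet.isClosed).mem_nhds ⟨ht, hS⟩
  obtain ⟨ε, hε, hb⟩ := Metric.mem_nhds_iff.mp hU
  rw [Real.ball_eq_Ioo] at hb
  have h1 : Icc (t - ε / 2) (t + ε / 2) ⊆ Ioo (t - ε) (t + ε) :=
    Icc_subset_Ioo (by linarith) (by linarith)
  have ha := hb (h1 (left_mem_Icc.mpr (by linarith)))
  have hb' := hb (h1 (right_mem_Icc.mpr (by linarith)))
  exact (h _ _ ha.1.1 (by linarith) hb'.1.2.le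
    fun u hu => (hb (h1 (Ioo_subset_Icc_self hu))).2).contDiffAt
    (Icc_mem_nhds (by linarith) (by linarith))

theorem IsBreakSet.intervalIntegrable_deriv {γ : ℝ → ℂ} {S : Finset ℝ} (h : IsBreakSet γ S)
    {a b : ℝ} (ha : 0 < a) (hab : a ≤ b) (hb : b ≤ 1) :
    IntervalIntegrable (deriv γ) MeasureTheory.volume a b := by
  classical
  -- Induction on the number of break points inside `(a, b)`: cutting at one of them leaves fewer on
  -- either side.
  induction hN : (S.filter fun t => t ∈ Ioo a b).card using Nat.strong_induction_on
    generalizing a b with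
  | _ N ih =>
    rcases hab.eq_or_lt with rfl | hab
    · exact IntervalIntegrable.refl
    by_cases hc : ∃ c ∈ S, c ∈ Ioo a b
    · obtain ⟨c, hcS, hc⟩ := hc
      refine (ih _ ?_ ha hc.1.le (hc.2.le.trans hb) rfl).trans
        (ih _ ?_ (ha.trans hc.1) hc.2.le hb rfl)
      · rw [← hN]
        refine Finset.card_lt_card ((Finset.ssubset_iff_of_subset ?_).mpr ⟨c, ?_, ?_⟩)
        · intro t ht
          simp only [Finset.mem_filter, mem_Ioo] at ht ⊢
          exact ⟨ht.1, ht.2.1, ht.2.2.trans hc.2⟩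
        · simpa [hcS] using hc
        · simp
      · rw [← hN]
        refine Finset.card_lt_card ((Finset.ssubset_iff_of_subset ?_).mpr ⟨c, ?_, ?_⟩)
        · intro t ht
          simp only [Finset.mem_filter, mem_Ioo] at ht ⊢
          exact ⟨ht.1, hc.1.trans ht.2.1, ht.2.2⟩
        · simpa [hcS] using hc
        · simp
    · push Not at hc
      have hC := h a b ha hab hb fun t ht hS => hc t hS ht
      have hd := hC.continuousOn_derivWithin (uniqueDiffOn_Icc hab) le_rfl
      rw [← uIcc_of_le hab.le] at hd
      refine hd.intervalIntegrable.congr_ae ?_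
      rw [uIoc_of_le hab.le, ← MeasureTheory.Measure.restrict_congr_set
        MeasureTheory.Ioo_ae_eq_Ioc]
      refine (MeasureTheory.ae_restrict_mem measurableSet_Ioo).mono fun t ht => ?_
      rw [uIcc_of_le hab.le]
      exact derivWithin_of_mem_nhds (Icc_mem_nhds ht.1 ht.2)

theorem IsTangentialPath.exists_isBreakSet {n : ℕ} {γ : ℝ → ℂ} {z : ℂ}
    (h : IsTangentialPath n γ z) : ∃ S, IsBreakSet γ S := h.piecewise

/-! ### The differential equation `dF = F ω` along a path -/

theorem eq_left_of_hasDerivAt_zero {f : ℝ → ℂ} {a b : ℝ} {S : Set ℝ} (hS : S.Countable)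
    (hf : ContinuousOn f (Icc a b)) (hd : ∀ t ∈ Ioo a b \ S, HasDerivAt f 0 t) {t : ℝ}
    (ht : t ∈ Icc a b) : f t = f a := by
  have := MeasureTheory.integral_eq_of_hasDerivAt_off_countable_of_le f (fun _ => 0) ht.1 hS
    (hf.mono (Icc_subset_Icc_right ht.2))
    (fun x hx => hd x ⟨⟨hx.1.1, hx.1.2.trans_le ht.2⟩, hx.2⟩) (by simp)
  simp only [intervalIntegral.integral_zero] at this
  exact (sub_eq_zero.mp this.symm)

/-- `F` is a solution on `[a, b]` of the differential equation `dF = F ω` pulled back by `γ`. -/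
structure IsHorizontal (n : ℕ) (γ : ℝ → ℂ) (a b : ℝ) (F : ℝ → NCSeries n) : Prop where
  continuousOn : ∀ w, ContinuousOn (fun t => F t w) (Icc a b)
  nil : ∀ t ∈ Icc a b, F t [] = F a []
  hasDerivAt : ∃ S : Set ℝ, S.Countable ∧ ∀ t ∈ Ioo a b \ S, ∀ (w : Word n) (x : Letter n),
    HasDerivAt (fun t => F t (w ++ [x])) (F t w * (logForm x (γ t) * deriv γ t)) t

/-- The system is triangular: the derivative at `w ++ [x]` involves only the coefficient at `w`. By
induction on the word, the difference of two solutions has zero derivative off a countable set, and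
continuity makes it constant. -/
theorem IsHorizontal.eq {n : ℕ} {γ : ℝ → ℂ} {a b : ℝ} {F G : ℝ → NCSeries n}
    (hF : IsHorizontal n γ a b F) (hG : IsHorizontal n γ a b G) (h : F a = G a) {t : ℝ}
    (ht : t ∈ Icc a b) : F t = G t := by
  obtain ⟨S, hS, hS'⟩ := hF.hasDerivAt
  obtain ⟨T, hT, hT'⟩ := hG.hasDerivAt
  suffices H : ∀ w : Word n, ∀ t ∈ Icc a b, F t w = G t w from funext fun w => H w t ht
  intro w
  induction w using List.reverseRecOn with
  | nil => intro t ht; rw [hF.nil t ht, hG.nil t ht, h]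
  | append_singleton w x ih =>
    intro t ht
    have := eq_left_of_hasDerivAt_zero (hS.union hT)
      ((hF.continuousOn (w ++ [x])).sub (hG.continuousOn (w ++ [x]))) (fun u hu => by
        have h1 := (hS' u ⟨hu.1, fun hh => hu.2 (Or.inl hh)⟩ w x).sub
          (hT' u ⟨hu.1, fun hh => hu.2 (Or.inr hh)⟩ w x)
        rw [ih u (Ioo_subset_Icc_self hu.1), sub_self] at h1
        exact h1) ht
    simp only [Pi.sub_apply, h, sub_self] at this
    exact sub_eq_zero.mp this

theorem IsHorizontal.mono {n : ℕ} {γ : ℝ → ℂ} {a b c d : ℝ} {F : ℝ → NCSeries n}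
    (hF : IsHorizontal n γ a b F) (hac : a ≤ c) (hcd : c ≤ d) (hdb : d ≤ b) :
    IsHorizontal n γ c d F := by
  obtain ⟨S, hS, hS'⟩ := hF.hasDerivAt
  refine ⟨fun w => (hF.continuousOn w).mono (Icc_subset_Icc hac hdb), fun t ht => ?_,
    S, hS, fun t ht => hS' t ⟨⟨hac.trans_lt ht.1.1, ht.1.2.trans_le hdb⟩, ht.2⟩⟩
  rw [hF.nil t ⟨hac.trans ht.1, ht.2.trans hdb⟩, hF.nil c ⟨hac, hcd.trans hdb⟩]

theorem NCSeries.mul_append {n : ℕ} (F G : NCSeries n) (w : Word n) (a : Letter n) :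
    NCSeries.mul F G (w ++ [a]) =
      ∑ k ∈ Finset.range (w.length + 1), F (w.take k) * G (w.drop k ++ [a]) +
        F (w ++ [a]) * G [] := by
  rw [NCSeries.mul, List.length_append, List.length_singleton, Finset.sum_range_succ]
  congr 1
  · refine Finset.sum_congr rfl fun k hk => ?_
    have hk' : k ≤ w.length := Nat.lt_succ_iff.mp (Finset.mem_range.mp hk)
    rw [List.take_append_of_le_length hk', List.drop_append_of_le_length hk']
  · rw [List.take_of_length_le (by simp), List.drop_of_length_le (by simp)]

theorem NCSeries.mul_nil {n : ℕ} (F G : NCSeries n) : NCSeries.mul F G [] = F [] * G [] := by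
  simp [NCSeries.mul]

/-- The form multiplies from the right, so constants on the left commute with the equation. -/
theorem IsHorizontal.const_mul {n : ℕ} {γ : ℝ → ℂ} {a b : ℝ} {F : ℝ → NCSeries n}
    (hF : IsHorizontal n γ a b F) (C : NCSeries n) :
    IsHorizontal n γ a b (fun t => NCSeries.mul C (F t)) := by
  obtain ⟨S, hS, hS'⟩ := hF.hasDerivAt
  refine ⟨fun w => ?_, fun t ht => ?_, S, hS, fun t ht w x => ?_⟩
  · exact continuousOn_finsetSum _ fun k _ => continuousOn_const.mul (hF.continuousOn _)
  · rw [NCSeries.mul_nil, NCSeries.mul_nil, hF.nil t ht]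
  · simp only [NCSeries.mul_append]
    have h1 : HasDerivAt (fun t => C (w ++ [x]) * F t []) 0 t := by
      refine (hasDerivAt_const t (C (w ++ [x]) * F a [])).congr_of_eventuallyEq ?_
      filter_upwards [Icc_mem_nhds ht.1.1 ht.1.2] with u hu
      rw [hF.nil u hu]
    refine ((HasDerivAt.fun_sum fun k (_ : k ∈ Finset.range (w.length + 1)) =>
      (hS' t ht (w.drop k) x).const_mul (C (w.take k))).add h1).congr_deriv ?_
    rw [NCSeries.mul, Finset.sum_mul, add_zero]
    exact Finset.sum_congr rfl fun k _ => by ring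

theorem Lambda_nil (n : ℕ) (γ : ℝ → ℂ) (s t : ℝ) : Lambda n γ s t [] = 1 := rfl

theorem Lambda_append {n : ℕ} (γ : ℝ → ℂ) (s t : ℝ) (w : Word n) (a : Letter n) :
    Lambda n γ s t (w ++ [a]) =
      ∫ τ in s..t, Lambda n γ s τ w * (logForm a (γ τ) * deriv γ τ) := by
  simp [Lambda, iterIntRev]

theorem Lambda_self_append {n : ℕ} (γ : ℝ → ℂ) (s : ℝ) (w : Word n) (a : Letter n) :
    Lambda n γ s s (w ++ [a]) = 0 := by
  rw [Lambda_append, intervalIntegral.integral_same]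

theorem Lambda_self_of_ne_nil {n : ℕ} (γ : ℝ → ℂ) (s : ℝ) {w : Word n} (hw : w ≠ []) :
    Lambda n γ s s w = 0 := by
  rw [← List.dropLast_append_getLast hw, Lambda_self_append]

theorem mul_Lambda_self {n : ℕ} (γ : ℝ → ℂ) (s : ℝ) (C : NCSeries n) :
    NCSeries.mul C (Lambda n γ s s) = C := by
  funext w
  rw [NCSeries.mul, Finset.sum_range_succ, Finset.sum_eq_zero, zero_add, List.drop_length,
    List.take_length, Lambda_nil, mul_one]
  intro k hk
  rw [Lambda_self_of_ne_nil, mul_zero]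
  rw [Ne, List.drop_eq_nil_iff]
  exact not_le.mpr (Finset.mem_range.mp hk)

theorem IsTangentialPath.isHorizontal_Lambda {n : ℕ} {γ : ℝ → ℂ} {z : ℂ}
    (h : IsTangentialPath n γ z) {s : ℝ} (hs : 0 < s) (hs1 : s ≤ 1) :
    IsHorizontal n γ s 1 (fun t => Lambda n γ s t) := by
  obtain ⟨S, hS⟩ := h.exists_isBreakSet
  have hγ : ContinuousOn γ (Icc s 1) := h.continuousOn.mono (Icc_subset_Icc_left hs.le)
  have hform : ∀ x : Letter n, ContinuousOn (fun t => logForm x (γ t)) (Icc s 1) :=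
    fun x t ht => (continuousAt_logForm x (h.mem_curve t ⟨hs.trans_le ht.1, ht.2⟩)).comp_continuousWithinAt
      (hγ t ht)
  have hint : ∀ (w : Word n) (x : Letter n), ContinuousOn (fun t => Lambda n γ s t w) (Icc s 1) →
      IntervalIntegrable (fun τ => Lambda n γ s τ w * (logForm x (γ τ) * deriv γ τ))
        MeasureTheory.volume s 1 := by
    intro w x hw
    have h1 := (hw.mul (hform x))
    rw [← uIcc_of_le hs1] at h1
    refine ((hS.intervalIntegrable_deriv hs hs1 le_rfl).continuousOn_mul h1).congr_ae ?_
    exact Eventually.of_forall fun t => by simp only [Pi.mul_apply]; ring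
  have hcont : ∀ w : Word n, ContinuousOn (fun t => Lambda n γ s t w) (Icc s 1) := by
    intro w
    induction w using List.reverseRecOn with
    | nil => exact continuousOn_const
    | append_singleton w x ih =>
      simp only [Lambda_append]
      have := intervalIntegral.continuousOn_primitive_interval' (hint w x ih) left_mem_uIcc
      rwa [uIcc_of_le hs1] at this
  refine ⟨hcont, fun t _ => rfl, S, S.countable_toSet, fun t ht w x => ?_⟩
  simp only [Lambda_append]
  have hU : IsOpen (Ioo s 1 \ (S : Set ℝ)) := isOpen_Ioo.sdiff S.finite_toSet.isClosed
  have hc : ContinuousOn (fun τ => Lambda n γ s τ w * (logForm x (γ τ) * deriv γ τ))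
      (Ioo s 1 \ (S : Set ℝ)) := by
    refine ((hcont w).mono (sdiff_subset.trans Ioo_subset_Icc_self)).mul
      (((hform x).mono (sdiff_subset.trans Ioo_subset_Icc_self)).mul fun u hu => ?_)
    exact ((hS.contDiffAt ⟨hs.trans hu.1.1, hu.1.2⟩ hu.2).derivWithin (m := 0)
      (by simp) |>.continuousAt).continuousWithinAt
  refine intervalIntegral.integral_hasDerivAt_right ((hint w x (hcont w)).mono_set ?_)
    (hc.stronglyMeasurableAtFilter hU t ht) (hc.continuousAt (hU.mem_nhds ht))
  rw [uIcc_of_le ht.1.1.le, uIcc_of_le hs1]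
  exact Icc_subset_Icc_right ht.1.2.le

/-! ### Growth at the tangential base point -/

/-- `f` is bounded by a power of `l` along the filter `u`. -/
def HasPolyGrowth {ι : Type*} (u : Filter ι) (l f : ι → ℂ) : Prop :=
  ∃ N : ℕ, f =O[u] fun i => l i ^ N

section PolyGrowth

variable {ι : Type*} {u : Filter ι} {l f g : ι → ℂ}

theorem isBigO_pow_of_le (hl : ∀ᶠ i in u, 1 ≤ ‖l i‖) {N M : ℕ} (h : N ≤ M) :
    (fun i => l i ^ N) =O[u] fun i => l i ^ M := by
  refine Asymptotics.IsBigO.of_bound 1 ?_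
  filter_upwards [hl] with i hi
  rw [norm_pow, norm_pow, one_mul]
  exact pow_le_pow_right₀ hi h

theorem HasPolyGrowth.add (hl : ∀ᶠ i in u, 1 ≤ ‖l i‖) (hf : HasPolyGrowth u l f)
    (hg : HasPolyGrowth u l g) : HasPolyGrowth u l (fun i => f i + g i) := by
  obtain ⟨N, hN⟩ := hf
  obtain ⟨M, hM⟩ := hg
  exact ⟨max N M, (hN.trans (isBigO_pow_of_le hl (le_max_left N M))).add
    (hM.trans (isBigO_pow_of_le hl (le_max_right N M)))⟩

theorem HasPolyGrowth.mul (hf : HasPolyGrowth u l f) (hg : HasPolyGrowth u l g) :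
    HasPolyGrowth u l (fun i => f i * g i) := by
  obtain ⟨N, hN⟩ := hf
  obtain ⟨M, hM⟩ := hg
  exact ⟨N + M, by simpa only [pow_add] using hN.mul hM⟩

theorem HasPolyGrowth.neg (hf : HasPolyGrowth u l f) : HasPolyGrowth u l (fun i => -f i) := by
  obtain ⟨N, hN⟩ := hf
  exact ⟨N, hN.neg_left⟩

theorem hasPolyGrowth_const (c : ℂ) : HasPolyGrowth u l (fun _ => c) :=
  ⟨0, by simpa using Asymptotics.isBigO_const_const c (one_ne_zero (α := ℂ)) u⟩

theorem HasPolyGrowth.sum {α : Type*} (hl : ∀ᶠ i in u, 1 ≤ ‖l i‖) (s : Finset α)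
    {F : α → ι → ℂ} (hF : ∀ k ∈ s, HasPolyGrowth u l (F k)) :
    HasPolyGrowth u l (fun i => ∑ k ∈ s, F k i) := by
  classical
  induction s using Finset.induction_on with
  | empty => simpa using hasPolyGrowth_const 0
  | insert a s ha ih =>
    simp only [Finset.sum_insert ha]
    exact (hF a (Finset.mem_insert_self a s)).add hl
      (ih fun k hk => hF k (Finset.mem_insert_of_mem hk))

theorem hasPolyGrowth_expX {n : ℕ} (w : Word n) :
    HasPolyGrowth u l (fun i => NCSeries.expX n (l i) w) := by
  simp only [NCSeries.expX]
  split_ifs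
  · refine ⟨w.length, ?_⟩
    simp only [div_eq_inv_mul]
    exact Asymptotics.isBigO_const_mul_self _ _ _
  · exact hasPolyGrowth_const 0

theorem tendsto_asympSol_sub_expX {n : ℕ} (w : Word n) {c : ℝ}
    (hre : Tendsto (fun i => (l i).re) u atBot) (him : Tendsto (fun i => (l i).im) u (𝓝 c))
    (hf : HasPolyGrowth u l f) :
    Tendsto (fun i => (asympSol n (l i) w - NCSeries.expX n (l i) w) * f i) u (𝓝 0) := by
  obtain ⟨N, hN⟩ := hf
  have h := tendsto_pow_mul_of_mem_logSpan (regPart n w).2 hre him N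
  refine ((Asymptotics.isBigO_refl (fun i => (regPart n w : ℂ → ℂ) (l i)) u).mul hN).trans_tendsto
    (h.congr fun i => mul_comm _ _) |>.congr fun i => ?_
  simp [asympSol]

theorem hasPolyGrowth_asympSol {n : ℕ} (hl : ∀ᶠ i in u, 1 ≤ ‖l i‖) {c : ℝ}
    (hre : Tendsto (fun i => (l i).re) u atBot) (him : Tendsto (fun i => (l i).im) u (𝓝 c))
    (w : Word n) : HasPolyGrowth u l (fun i => asympSol n (l i) w) := by
  have h := tendsto_asympSol_sub_expX w hre him (hasPolyGrowth_const 1)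
  have h2 : HasPolyGrowth u l
      (fun i => (asympSol n (l i) w - NCSeries.expX n (l i) w) * 1) :=
    ⟨0, by simpa using h.isBigO_one ℂ⟩
  simpa using h2.add hl (hasPolyGrowth_expX w)

end PolyGrowth

/-! ### Logarithms along the path and existence of the regularized limits -/

/-- `l` is a logarithm of `γ` on `(0, δ]`, which is the principal one near `0`. -/
structure IsLogLift (γ : ℝ → ℂ) (δ : ℝ) (l : ℝ → ℂ) : Prop where
  continuousOn : ContinuousOn l (Ioc 0 δ)
  exp_eq : ∀ t ∈ Ioc 0 δ, Complex.exp (l t) = γ t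
  tendsto_im : Tendsto (fun t => (l t).im) (𝓝[>] 0) (𝓝 0)
  differentiableAt : ∃ S : Set ℝ, S.Countable ∧ ∀ t ∈ Ioo 0 δ \ S, DifferentiableAt ℝ l t

theorem IsLogLift.log_eq {γ : ℝ → ℂ} {δ : ℝ} {l : ℝ → ℂ} (h : IsLogLift γ δ l) (hδ : 0 < δ) :
    ∀ᶠ t in 𝓝[>] 0, Complex.log (γ t) = l t := by
  filter_upwards [Ioc_mem_nhdsGT hδ, h.tendsto_im.eventually
    (Ioo_mem_nhds (neg_lt_zero.mpr Real.pi_pos) Real.pi_pos)] with t ht hi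
  rw [← h.exp_eq t ht, Complex.log_exp hi.1 hi.2.le]

theorem IsLogLift.re_neg {γ : ℝ → ℂ} {δ : ℝ} {l : ℝ → ℂ} (h : IsLogLift γ δ l)
    (hlt : ∀ t ∈ Ioc 0 δ, ‖γ t‖ < 1) {t : ℝ} (ht : t ∈ Ioc 0 δ) : (l t).re < 0 := by
  have := hlt t ht
  rwa [← h.exp_eq t ht, Complex.norm_exp, Real.exp_lt_one_iff] at this

theorem IsTangentialPath.tendsto_zero {n : ℕ} {γ : ℝ → ℂ} {z : ℂ} (h : IsTangentialPath n γ z) :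
    Tendsto γ (𝓝[>] 0) (𝓝 0) := by
  have h1 := h.continuousOn 0 (left_mem_Icc.mpr zero_le_one)
  rw [ContinuousWithinAt, h.map_zero] at h1
  refine h1.mono_left (le_inf nhdsWithin_le_nhds (le_principal_iff.mpr ?_))
  exact mem_of_superset (Ioc_mem_nhdsGT one_pos) Ioc_subset_Icc_self

theorem IsLogLift.tendsto_re {n : ℕ} {γ : ℝ → ℂ} {z : ℂ} (h : IsTangentialPath n γ z) {δ : ℝ}
    {l : ℝ → ℂ} (hl : IsLogLift γ δ l) (hδ : 0 < δ) :
    Tendsto (fun t => (l t).re) (𝓝[>] 0) atBot := by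
  refine Complex.tendsto_exp_nhds_zero_iff.mp (h.tendsto_zero.congr' ?_)
  filter_upwards [Ioc_mem_nhdsGT hδ] with t ht
  rw [hl.exp_eq t ht]

theorem continuousAt_asympSol {n : ℕ} (w : Word n) {l : ℂ} (hl : l.re < 0) :
    ContinuousAt (fun l => asympSol n l w) l := by
  induction w using List.reverseRecOn with
  | nil => simpa only [asympSol_nil] using continuousAt_const
  | append_singleton w a _ => exact (hasDerivAt_asympSol w a hl).continuousAt

theorem IsLogLift.isHorizontal {γ : ℝ → ℂ} {δ : ℝ} {l : ℝ → ℂ} (h : IsLogLift γ δ l)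
    (hlt : ∀ t ∈ Ioc 0 δ, ‖γ t‖ < 1) (n : ℕ) {s : ℝ} (hs : 0 < s) :
    IsHorizontal n γ s δ (fun t => asympSol n (l t)) := by
  have hsub : Icc s δ ⊆ Ioc 0 δ := fun t ht => ⟨hs.trans_le ht.1, ht.2⟩
  obtain ⟨S, hS, hS'⟩ := h.differentiableAt
  refine ⟨fun w t ht => ?_, fun t _ => by simp only [asympSol_nil], S, hS, fun t ht w x => ?_⟩
  · exact (continuousAt_asympSol w (h.re_neg hlt (hsub ht))).comp_continuousWithinAt
      ((h.continuousOn t (hsub ht)).mono hsub)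
  · have ht' : t ∈ Ioc 0 δ := ⟨hs.trans ht.1.1, ht.1.2.le⟩
    have h1 := (hS' t ⟨⟨ht'.1, ht.1.2⟩, ht.2⟩).hasDerivAt
    have h2 := (hasDerivAt_asympSol w x (h.re_neg hlt ht')).comp_of_eq t h1 rfl
    have h3 : HasDerivAt γ (Complex.exp (l t) * deriv l t) t := by
      refine h1.cexp.congr_of_eventuallyEq ?_
      filter_upwards [Ioo_mem_nhds ht.1.1 ht.1.2] with u hu
      exact (h.exp_eq u ⟨hs.trans hu.1, hu.2.le⟩).symm
    refine h2.congr_deriv ?_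
    rw [h3.deriv, h.exp_eq t ht']
    ring

/-- As a function of `t`, `asympSol (l s) · Λ(s, t)` and `asympSol (l t)` solve the same equation on
`[s, δ]` and agree at `t = s`, hence at `t = δ`. From there on, both sides are continued by the same
equation up to `t = 1`. -/
theorem IsLogLift.mul_Lambda_eq {n : ℕ} {γ : ℝ → ℂ} {z : ℂ} (h : IsTangentialPath n γ z) {δ : ℝ}
    (hδ1 : δ ≤ 1) {l : ℝ → ℂ} (hl : IsLogLift γ δ l) (hlt : ∀ t ∈ Ioc 0 δ, ‖γ t‖ < 1) {s : ℝ}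
    (hs : s ∈ Ioc 0 δ) :
    NCSeries.mul (asympSol n (l s)) (Lambda n γ s 1) =
      NCSeries.mul (asympSol n (l δ)) (Lambda n γ δ 1) := by
  have h1 := (h.isHorizontal_Lambda hs.1 (hs.2.trans hδ1)).const_mul (asympSol n (l s))
  have h2 := (h.isHorizontal_Lambda (hs.1.trans_le hs.2) hδ1).const_mul (asympSol n (l δ))
  refine (h1.mono hs.2 hδ1 le_rfl).eq h2 ?_ (right_mem_Icc.mpr hδ1)
  rw [mul_Lambda_self]
  exact (h1.mono le_rfl hs.2 hδ1).eq (hl.isHorizontal hlt n hs.1) (mul_Lambda_self _ _ _)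
    (right_mem_Icc.mpr hs.2)

/-- In the constant product `asympSol (l s) · Λ(s, 1)` the coefficient of `Λ(s, 1)` at `w` itself is
`1`, and all other terms contain `Λ(s, 1)` only at proper suffixes of `w`. Solving for it gives an
induction on the length. -/
theorem IsLogLift.hasPolyGrowth_Lambda {n : ℕ} {γ : ℝ → ℂ} {z : ℂ} (h : IsTangentialPath n γ z)
    {δ : ℝ} (hδ : 0 < δ) (hδ1 : δ ≤ 1) {l : ℝ → ℂ} (hl : IsLogLift γ δ l)
    (hlt : ∀ t ∈ Ioc 0 δ, ‖γ t‖ < 1) (w : Word n) :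
    HasPolyGrowth (𝓝[>] 0) l (fun s => Lambda n γ s 1 w) := by
  have hre := hl.tendsto_re h hδ
  have h1 : ∀ᶠ s in 𝓝[>] 0, 1 ≤ ‖l s‖ := by
    filter_upwards [hre.eventually (eventually_le_atBot (-1))] with s hs
    have := (neg_le_abs _).trans (Complex.abs_re_le_norm (l s))
    linarith
  induction hN : w.length using Nat.strong_induction_on generalizing w with
  | _ N ih =>
    have h2 : HasPolyGrowth (𝓝[>] 0) l
        (fun s => NCSeries.mul (asympSol n (l δ)) (Lambda n γ δ 1) w +
          -∑ k ∈ Finset.range w.length,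
            asympSol n (l s) (w.take (k + 1)) * Lambda n γ s 1 (w.drop (k + 1))) := by
      refine (hasPolyGrowth_const _).add h1 (HasPolyGrowth.neg (HasPolyGrowth.sum h1 _ ?_))
      intro k hk
      have hk' := Finset.mem_range.mp hk
      refine (hasPolyGrowth_asympSol h1 hre hl.tendsto_im _).mul (ih _ ?_ _ rfl)
      rw [List.length_drop]
      omega
    obtain ⟨M, hM⟩ := h2
    refine ⟨M, hM.congr' ?_ EventuallyEq.rfl⟩
    filter_upwards [Ioc_mem_nhdsGT hδ] with s hs
    rw [← hl.mul_Lambda_eq h hδ1 hlt hs, NCSeries.mul, Finset.sum_range_succ']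
    simp [asympSol_nil]

theorem IsLogLift.tendsto_regLambda {n : ℕ} {γ : ℝ → ℂ} {z : ℂ} (h : IsTangentialPath n γ z)
    {δ : ℝ} (hδ : 0 < δ) (hδ1 : δ ≤ 1) {l : ℝ → ℂ} (hl : IsLogLift γ δ l)
    (hlt : ∀ t ∈ Ioc 0 δ, ‖γ t‖ < 1) (w : Word n) :
    Tendsto (fun s => regLambda n γ s w) (𝓝[>] 0)
      (𝓝 (NCSeries.mul (asympSol n (l δ)) (Lambda n γ δ 1) w)) := by
  -- The regularized series is the constant product minus `(asympSol (l s) - exp (l s X)) · Λ(s,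
  -- 1)`, in which rapid decay meets polynomial growth.
  have h1 : Tendsto (fun s => NCSeries.mul (asympSol n (l δ)) (Lambda n γ δ 1) w -
      ∑ k ∈ Finset.range (w.length + 1),
        (asympSol n (l s) (w.take k) - NCSeries.expX n (l s) (w.take k)) *
          Lambda n γ s 1 (w.drop k)) (𝓝[>] 0)
      (𝓝 (NCSeries.mul (asympSol n (l δ)) (Lambda n γ δ 1) w -
        ∑ k ∈ Finset.range (w.length + 1), 0)) :=
    tendsto_const_nhds.sub (tendsto_finsetSum _ fun k _ =>
      tendsto_asympSol_sub_expX _ (hl.tendsto_re h hδ) hl.tendsto_im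
        (hl.hasPolyGrowth_Lambda h hδ hδ1 hlt _))
  rw [Finset.sum_const_zero, sub_zero] at h1
  refine h1.congr' ?_
  filter_upwards [Ioc_mem_nhdsGT hδ, hl.log_eq hδ] with s hs hlog
  rw [← hl.mul_Lambda_eq h hδ1 hlt hs, regLambda, hlog, NCSeries.mul, NCSeries.mul,
    ← Finset.sum_sub_distrib]
  exact Finset.sum_congr rfl fun k _ => by ring

theorem IsTangentialPath.eventually_re_pos {n : ℕ} {γ : ℝ → ℂ} {z : ℂ}
    (h : IsTangentialPath n γ z) : ∀ᶠ t in 𝓝[>] 0, 0 < (γ t).re := by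
  have h1 := (Complex.continuous_re.tendsto _).comp h.direction
  filter_upwards [h1.eventually (lt_mem_nhds (show (0 : ℝ) < (1 : ℂ).re by simp))] with t ht
  simp only [Function.comp_apply, Complex.div_ofReal_re] at ht
  exact (div_pos_iff_of_pos_right ((norm_nonneg _).lt_of_ne' fun h0 => by simp [h0] at ht)).mp ht

theorem IsTangentialPath.tendsto_arg {n : ℕ} {γ : ℝ → ℂ} {z : ℂ}
    (h : IsTangentialPath n γ z) : Tendsto (fun t => (γ t).arg) (𝓝[>] 0) (𝓝 0) := by
  have h1 := (Complex.continuousAt_arg Complex.one_mem_slitPlane).tendsto.comp h.direction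
  rw [Complex.arg_one] at h1
  refine h1.congr' ?_
  filter_upwards [Ioc_mem_nhdsGT one_pos] with t ht
  have h0 : 0 < ‖γ t‖⁻¹ := inv_pos.mpr (norm_pos_iff.mpr (h.mem_curve t ht).1)
  rw [Function.comp_apply, div_eq_inv_mul, ← Complex.ofReal_inv, Complex.arg_real_mul _ h0]

/-- Near `0` the path lies in the right half-plane, where the principal logarithm serves. It is
continued to `δ` by integrating `dγ/γ`; this works even if the path winds around `0`. -/
theorem IsTangentialPath.exists_isLogLift {n : ℕ} {γ : ℝ → ℂ} {z : ℂ}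
    (h : IsTangentialPath n γ z) {δ : ℝ} (hδ : 0 < δ) (hδ1 : δ ≤ 1) :
    ∃ l, IsLogLift γ δ l := by
  obtain ⟨S, hS⟩ := h.exists_isBreakSet
  obtain ⟨ε, hε, hb⟩ := mem_nhdsGT_iff_exists_Ioc_subset.mp h.eventually_re_pos
  set c := min ε δ with hc_def
  have hc : 0 < c := lt_min hε hδ
  have hcδ : c ≤ δ := min_le_right _ _
  have hslit : ∀ t ∈ Ioc 0 c, γ t ∈ Complex.slitPlane := fun t ht =>
    Or.inl (hb ⟨ht.1, ht.2.trans (min_le_left _ _)⟩)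
  have hne : ∀ t ∈ Ioc 0 δ, γ t ≠ 0 := fun t ht => (h.mem_curve t ⟨ht.1, ht.2.trans hδ1⟩).1
  have hγ : ContinuousOn γ (Ioc 0 1) := h.continuousOn.mono Ioc_subset_Icc_self
  have hint : ∀ a b, 0 < a → a ≤ b → b ≤ δ →
      IntervalIntegrable (fun t => deriv γ t / γ t) MeasureTheory.volume a b := by
    intro a b ha hab hbδ
    simp only [div_eq_mul_inv]
    refine (hS.intervalIntegrable_deriv ha hab (hbδ.trans hδ1)).mul_continuousOn ?_
    rw [uIcc_of_le hab]
    exact (hγ.mono fun t ht => ⟨ha.trans_le ht.1, ht.2.trans (hbδ.trans hδ1)⟩).inv₀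
      fun t ht => hne t ⟨ha.trans_le ht.1, ht.2.trans hbδ⟩
  have hdγ : ∀ t ∈ Ioo 0 δ \ (S : Set ℝ), HasDerivAt γ (deriv γ t) t := fun t ht =>
    ((hS.contDiffAt ⟨ht.1.1, ht.1.2.trans_le hδ1⟩ ht.2).differentiableAt (by simp)).hasDerivAt
  set l : ℝ → ℂ := fun t => Complex.log (γ c) + ∫ τ in c..t, deriv γ τ / γ τ with hl_def
  have hcont : ∀ a, 0 < a → a ≤ c → ContinuousOn l (Icc a δ) := by
    intro a ha hac
    have := intervalIntegral.continuousOn_primitive_interval' (hint a δ ha (hac.trans hcδ) le_rfl)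
      (a := c) (by rw [uIcc_of_le (hac.trans hcδ)]; exact ⟨hac, hcδ⟩)
    rw [uIcc_of_le (hac.trans hcδ)] at this
    exact continuousOn_const.add this
  have hU : IsOpen (Ioo 0 δ \ (S : Set ℝ)) := isOpen_Ioo.sdiff S.finite_toSet.isClosed
  have hfc : ContinuousOn (fun t => deriv γ t / γ t) (Ioo 0 δ \ (S : Set ℝ)) := by
    refine ContinuousOn.div (fun u hu => ?_)
      (hγ.mono fun t ht => ⟨ht.1.1, ht.1.2.le.trans hδ1⟩) fun t ht => hne t ⟨ht.1.1, ht.1.2.le⟩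
    exact ((hS.contDiffAt ⟨hu.1.1, hu.1.2.trans_le hδ1⟩ hu.2).derivWithin (m := 0)
      (by simp) |>.continuousAt).continuousWithinAt
  have hderiv : ∀ t ∈ Ioo 0 δ \ (S : Set ℝ), HasDerivAt l (deriv γ t / γ t) t := by
    intro t ht
    refine (intervalIntegral.integral_hasDerivAt_right ?_
      (hfc.stronglyMeasurableAtFilter hU t ht) (hfc.continuousAt (hU.mem_nhds ht))).const_add _
    rcases le_total c t with h' | h'
    · exact hint c t hc h' ht.1.2.le
    · exact (hint t c ht.1.1 h' hcδ).symm
  have hlog : ∀ t ∈ Ioc 0 c, l t = Complex.log (γ t) := by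
    intro t ht
    have hsub : Icc t c ⊆ Ioc 0 c := fun u hu => ⟨ht.1.trans_le hu.1, hu.2⟩
    have := MeasureTheory.integral_eq_of_hasDerivAt_off_countable_of_le
      (fun u => Complex.log (γ u)) (fun u => deriv γ u / γ u) ht.2 S.countable_toSet
      ((hγ.mono fun u hu => ⟨(hsub hu).1, (hsub hu).2.trans (hcδ.trans hδ1)⟩).clog
        fun u hu => hslit u (hsub hu))
      (fun u hu => (hdγ u ⟨⟨ht.1.trans hu.1.1, hu.1.2.trans_le hcδ⟩, hu.2⟩).clog_real
        (hslit u (hsub (Ioo_subset_Icc_self hu.1))))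
      (hint t c ht.1 ht.2 hcδ)
    simp only [hl_def]
    rw [intervalIntegral.integral_symm, this]
    ring
  refine ⟨l, fun t ht => ?_, fun t ht => ?_, ?_, S, S.countable_toSet, fun t ht =>
    (hderiv t ht).differentiableAt⟩
  -- Continuity is known on closed intervals `[a, δ]` with `a ≤ c`; this choice of `a` makes the
  -- interval a neighbourhood of `t` within `(0, δ]`.
  · refine (hcont (min (t / 2) c) (lt_min (half_pos ht.1) hc) (min_le_right _ _)
      t ⟨(min_le_left _ _).trans (half_le_self ht.1.le), ht.2⟩).mono_of_mem_nhdsWithin ?_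
    rw [mem_nhdsWithin]
    refine ⟨Ioi (t / 2), isOpen_Ioi, half_lt_self ht.1, fun u hu => ?_⟩
    exact ⟨(min_le_left _ _).trans (le_of_lt hu.1), hu.2.2⟩
  · rcases le_total t c with h' | h'
    · rw [hlog t ⟨ht.1, h'⟩, Complex.exp_log (hne t ht)]
    -- The product `γ * exp (-l)` has zero derivative off the break points and equals `1` at `c`.
    · have := eq_left_of_hasDerivAt_zero (f := fun u => γ u * Complex.exp (-l u)) (a := c) (b := δ)
        S.countable_toSet
        ((hγ.mono fun u hu => ⟨hc.trans_le hu.1, hu.2.trans hδ1⟩).mul (hcont c hc le_rfl).neg.cexp)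
        (fun u hu => by
          have hu' : u ∈ Ioo 0 δ \ (S : Set ℝ) := ⟨⟨hc.trans hu.1.1, hu.1.2⟩, hu.2⟩
          refine ((hdγ u hu').mul (hderiv u hu').neg.cexp).congr_deriv ?_
          have := hne u ⟨hu'.1.1, hu'.1.2.le⟩
          simp only [Pi.neg_apply]
          field_simp
          ring) ⟨h', ht.2⟩
      simp only [hlog c ⟨hc, le_rfl⟩, Complex.exp_neg] at this
      rw [Complex.exp_log (hne c ⟨hc, hcδ⟩), mul_inv_cancel₀ (hne c ⟨hc, hcδ⟩),
        mul_inv_eq_one₀ (Complex.exp_ne_zero _)] at this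
      exact this.symm
  · refine h.tendsto_arg.congr' ?_
    filter_upwards [Ioc_mem_nhdsGT hc] with t ht
    rw [hlog t ht, Complex.log_im]

theorem IsTangentialPath.exists_norm_lt_one {n : ℕ} {γ : ℝ → ℂ} {z : ℂ}
    (h : IsTangentialPath n γ z) : ∃ δ, 0 < δ ∧ δ ≤ 1 ∧ ∀ t ∈ Ioc 0 δ, ‖γ t‖ < 1 := by
  have h1 := h.tendsto_zero.norm
  rw [norm_zero] at h1
  obtain ⟨ε, hε, hb⟩ := mem_nhdsGT_iff_exists_Ioc_subset.mp (h1.eventually (gt_mem_nhds one_pos))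
  exact ⟨min ε 1, lt_min hε one_pos, min_le_right _ _, fun t ht =>
    hb ⟨ht.1, ht.2.trans (min_le_left _ _)⟩⟩

theorem IsLogLift.liConverges {n : ℕ} {γ : ℝ → ℂ} {z : ℂ} (h : IsTangentialPath n γ z)
    {δ : ℝ} (hδ : 0 < δ) (hδ1 : δ ≤ 1) {l : ℝ → ℂ} (hl : IsLogLift γ δ l)
    (hlt : ∀ t ∈ Ioc 0 δ, ‖γ t‖ < 1) (w : Word n) :
    LiConverges n γ w :=
  tendsto_nhds_limUnder ⟨_, hl.tendsto_regLambda h hδ hδ1 hlt w⟩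

theorem IsTangentialPath.liConverges {n : ℕ} {γ : ℝ → ℂ} {z : ℂ} (h : IsTangentialPath n γ z)
    (w : Word n) : LiConverges n γ w := by
  obtain ⟨δ, hδ, hδ1, hlt⟩ := h.exists_norm_lt_one
  obtain ⟨l, hl⟩ := h.exists_isLogLift hδ hδ1
  exact hl.liConverges h hδ hδ1 hlt w

theorem IsLogLift.liWord_eq {n : ℕ} {γ : ℝ → ℂ} {z : ℂ} (h : IsTangentialPath n γ z)
    {δ : ℝ} (hδ : 0 < δ) (hδ1 : δ ≤ 1) {l : ℝ → ℂ} (hl : IsLogLift γ δ l)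
    (hlt : ∀ t ∈ Ioc 0 δ, ‖γ t‖ < 1) (w : Word n) :
    LiWord n γ w = NCSeries.mul (asympSol n (l δ)) (Lambda n γ δ 1) w :=
  (hl.tendsto_regLambda h hδ hδ1 hlt w).limUnder_eq

/-! ### Roots of unity and congruent words -/

theorem zetaRoot_mul_pow_left (r n : ℕ) [NeZero r] : zetaRoot (r * n) ^ r = zetaRoot n := by
  rw [zetaRoot, zetaRoot, ← Complex.exp_nat_mul]
  congr 1
  have : (r : ℂ) ≠ 0 := Nat.cast_ne_zero.mpr (NeZero.ne r)
  push_cast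
  rw [← mul_div_assoc, mul_div_mul_left _ _ this]

theorem zetaRoot_mul_pow_right (r n : ℕ) [NeZero n] : zetaRoot (r * n) ^ n = zetaRoot r := by
  rw [mul_comm, zetaRoot_mul_pow_left]

theorem prod_sub_mul_zetaRoot_pow (n : ℕ) [NeZero n] (z y : ℂ) :
    ∏ k : Fin n, (z - y * zetaRoot n ^ (k : ℕ)) = z ^ n - y ^ n := by
  have h := isPrimitiveRoot_zetaRoot n
  rw [h.pow_sub_pow_eq_prod_sub_mul z y (NeZero.pos n),
    Fin.prod_univ_eq_prod_range (fun k => z - y * zetaRoot n ^ k) n]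
  refine Finset.prod_nbij (fun k => zetaRoot n ^ k) (fun k _ => ?_) ?_ (fun x hx => ?_)
    (fun k _ => by rw [mul_comm])
  · rw [Polynomial.mem_nthRootsFinset (NeZero.pos n), ← pow_mul, mul_comm, pow_mul,
      h.pow_eq_one, one_pow]
  · intro a ha b hb hab
    exact h.pow_inj (Finset.mem_range.mp ha) (Finset.mem_range.mp hb) hab
  · have hx' := (Polynomial.mem_nthRootsFinset (NeZero.pos n) 1).mp hx
    obtain ⟨k, hk, rfl⟩ := h.eq_pow_of_pow_eq_one hx'
    exact ⟨k, by simpa using hk, rfl⟩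

/-- Logarithmic derivative of the factorization of `z ^ n - y ^ n`. -/
theorem sum_one_div_sub_mul_zetaRoot_pow (n : ℕ) [NeZero n] {z y : ℂ} (h : z ^ n ≠ y ^ n) :
    ∑ k : Fin n, 1 / (z - y * zetaRoot n ^ (k : ℕ)) = n * z ^ (n - 1) / (z ^ n - y ^ n) := by
  have h0 : ∀ k ∈ (Finset.univ : Finset (Fin n)), z - y * zetaRoot n ^ (k : ℕ) ≠ 0 :=
    Finset.prod_ne_zero_iff.mp (by rw [prod_sub_mul_zetaRoot_pow]; exact sub_ne_zero.mpr h)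
  have h1 := logDeriv_prod (f := fun (k : Fin n) (z : ℂ) => z - y * zetaRoot n ^ (k : ℕ)) h0
    (fun k _ => by fun_prop)
  simp only [prod_sub_mul_zetaRoot_pow] at h1
  simp only [logDeriv_apply, deriv_sub_const, deriv_pow_field] at h1
  simpa using h1.symm

theorem Letter.modulo_self {r : ℕ} [NeZero r] (a : Letter r) : a.modulo r = a := by
  cases a with
  | X => rfl
  | Y i => simp [Letter.modulo, Nat.mod_eq_of_lt i.isLt]

theorem mem_congrWords {r m : ℕ} [NeZero r] {u : Word m} {w : Word r} :
    u ∈ congrWords r m w ↔ u.map (Letter.modulo r) = w := by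
  have : w.map (Letter.modulo r) = w := by
    rw [show (Letter.modulo r : Letter r → Letter r) = id from funext Letter.modulo_self,
      List.map_id]
  simp [congrWords, CongrMod, this]

theorem length_of_mem_congrWords {r m : ℕ} [NeZero r] {u : Word m} {w : Word r}
    (h : u ∈ congrWords r m w) : u.length = w.length := by
  rw [← mem_congrWords.mp h, List.length_map]

theorem sum_congrWords_append {r m : ℕ} [NeZero r] (w v : Word r) (f : Word m → ℂ) :
    ∑ u ∈ congrWords r m (w ++ v), f u =
      ∑ u ∈ congrWords r m w, ∑ u' ∈ congrWords r m v, f (u ++ u') := by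
  rw [← Finset.sum_product']
  refine Finset.sum_nbij' (fun u => (u.take w.length, u.drop w.length)) (fun p => p.1 ++ p.2)
    (fun u hu => ?_) (fun p hp => ?_) (fun u _ => List.take_append_drop _ _) (fun p hp => ?_)
    (fun u _ => by rw [List.take_append_drop])
  · rw [mem_congrWords] at hu
    rw [Finset.mem_product, mem_congrWords, mem_congrWords, List.map_take, List.map_drop, hu]
    simp
  · rw [Finset.mem_product, mem_congrWords, mem_congrWords] at hp
    rw [mem_congrWords, List.map_append, hp.1, hp.2]
  · have h := length_of_mem_congrWords (Finset.mem_product.mp hp).1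
    simp [← h]

theorem sum_congrWords_X {r m : ℕ} [NeZero r] (f : Word m → ℂ) :
    ∑ u ∈ congrWords r m ([Letter.X] : Word r), f u = f [Letter.X] := by
  rw [show congrWords r m ([Letter.X] : Word r) = {[Letter.X]} from ?_, Finset.sum_singleton]
  ext u
  rw [mem_congrWords, Finset.mem_singleton, List.map_eq_singleton_iff]
  constructor
  · rintro ⟨a, rfl, ha⟩
    cases a with
    | X => rfl
    | Y i => simp [Letter.modulo] at ha
  · rintro rfl
    exact ⟨_, rfl, rfl⟩

theorem add_mul_lt_mul {r n i k : ℕ} (hi : i < r) (hk : k < n) : i + r * k < r * n :=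
  calc i + r * k < r + r * k := by omega
    _ = r * (k + 1) := by ring
    _ ≤ r * n := Nat.mul_le_mul_left r hk

theorem sum_congrWords_Y {r n : ℕ} [NeZero r] (i : Fin r) (f : Word (r * n) → ℂ) :
    ∑ u ∈ congrWords r (r * n) [Letter.Y i], f u =
      ∑ k : Fin n, f [Letter.Y ⟨i + r * k, add_mul_lt_mul i.isLt k.isLt⟩] := by
  symm
  refine Finset.sum_nbij (fun k : Fin n => [Letter.Y ⟨i + r * k, add_mul_lt_mul i.isLt k.isLt⟩])
    (fun k _ => ?_) (fun k _ k' _ h => ?_) (fun u hu => ?_) (fun _ _ => rfl)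
  · rw [mem_congrWords]
    simp [Letter.modulo, Nat.mod_eq_of_lt i.isLt]
  · simp only [List.cons.injEq, Letter.Y.injEq, Fin.mk.injEq, and_true, add_right_inj] at h
    exact Fin.ext (Nat.eq_of_mul_eq_mul_left (NeZero.pos r) h)
  · rw [Finset.mem_coe, mem_congrWords, List.map_eq_singleton_iff] at hu
    obtain ⟨a, rfl, ha⟩ := hu
    cases a with
    | X => simp [Letter.modulo] at ha
    | Y j =>
      simp only [Letter.modulo, Letter.Y.injEq] at ha
      refine ⟨⟨j / r, Nat.div_lt_of_lt_mul j.isLt⟩, Finset.mem_coe.mpr (Finset.mem_univ _), ?_⟩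
      subst ha
      simp [Nat.mod_add_div]

/-! ### Direct image under the power map, and part (a) -/

/-- The direct image of a power series under `z ↦ z ^ n`. -/
noncomputable def pushSeries (r m n : ℕ) [NeZero r] (F : NCSeries m) : NCSeries r :=
  fun w => (n : ℂ) ^ wtX w * ∑ u ∈ congrWords r m w, F u

/-- A word congruent to `w` splits at position `k` into words congruent to the two pieces of `w`,
bijectively, and the `X`-weight is additive. -/
theorem pushSeries_mul (r m n : ℕ) [NeZero r] (F G : NCSeries m) :
    pushSeries r m n (NCSeries.mul F G) =
      NCSeries.mul (pushSeries r m n F) (pushSeries r m n G) := by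
  funext w
  simp only [pushSeries, NCSeries.mul]
  rw [Finset.sum_congr rfl fun u hu => by rw [length_of_mem_congrWords hu], Finset.sum_comm,
    Finset.mul_sum]
  refine Finset.sum_congr rfl fun k hk => ?_
  have hk' : k ≤ w.length := Nat.lt_succ_iff.mp (Finset.mem_range.mp hk)
  have h1 : wtX w = wtX (w.take k) + wtX (w.drop k) := by
    rw [wtX, wtX, wtX, ← List.count_append, List.take_append_drop]
  have h2 := sum_congrWords_append (w.take k) (w.drop k)
    (fun u : Word m => F (u.take k) * G (u.drop k))
  rw [List.take_append_drop] at h2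
  rw [h2, h1, pow_add, mul_mul_mul_comm, Finset.sum_mul_sum]
  congr 1
  refine Finset.sum_congr rfl fun u hu => Finset.sum_congr rfl fun u' _ => ?_
  have h3 : u.length = k := by
    rw [length_of_mem_congrWords hu, List.length_take, min_eq_left hk']
  rw [List.take_left' h3, List.drop_left' h3]

theorem pushSeries_expX (r m n : ℕ) [NeZero r] (c : ℂ) :
    pushSeries r m n (NCSeries.expX m c) = NCSeries.expX r (n * c) := by
  funext w
  simp only [pushSeries]
  by_cases hw : w = List.replicate w.length Letter.X
  · have h1 : wtX w = w.length := by
      rw [wtX, hw, List.count_replicate_self, List.length_replicate]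
    have hmem : List.replicate w.length Letter.X ∈ congrWords r m w := by
      rw [mem_congrWords, List.map_replicate]
      exact hw.symm
    rw [Finset.sum_eq_single_of_mem _ hmem, h1, NCSeries.expX, NCSeries.expX, if_pos hw,
      if_pos (by rw [List.length_replicate]), List.length_replicate, mul_pow, mul_div_assoc]
    intro u hu hne
    rw [NCSeries.expX, if_neg]
    rwa [length_of_mem_congrWords hu]
  · rw [NCSeries.expX, if_neg hw, Finset.sum_eq_zero, mul_zero]
    intro u hu
    rw [NCSeries.expX, if_neg]
    intro h
    apply hw
    have h2 := mem_congrWords.mp hu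
    rw [h, List.map_replicate, length_of_mem_congrWords hu] at h2
    exact h2.symm

theorem pushSeries_nil (r m n : ℕ) [NeZero r] (F : NCSeries m) :
    pushSeries r m n F [] = F [] := by
  have : congrWords r m ([] : Word r) = {[]} := by
    ext u
    rw [mem_congrWords, List.map_eq_nil_iff, Finset.mem_singleton]
  simp [pushSeries, this, wtX]

theorem pushSeries_append_X {r m n : ℕ} [NeZero r] (F : NCSeries m) (w : Word r) :
    pushSeries r m n F (w ++ [Letter.X]) =
      (n : ℂ) ^ wtX w * n * ∑ u ∈ congrWords r m w, F (u ++ [Letter.X]) := by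
  rw [pushSeries, sum_congrWords_append, wtX, List.count_append, pow_add]
  simp only [sum_congrWords_X]
  simp [wtX]

theorem pushSeries_append_Y {r n : ℕ} [NeZero r] (F : NCSeries (r * n)) (w : Word r)
    (i : Fin r) :
    pushSeries r (r * n) n F (w ++ [Letter.Y i]) =
      (n : ℂ) ^ wtX w * ∑ u ∈ congrWords r (r * n) w,
        ∑ k : Fin n, F (u ++ [Letter.Y ⟨i + r * k, add_mul_lt_mul i.isLt k.isLt⟩]) := by
  rw [pushSeries, sum_congrWords_append, wtX, List.count_append, pow_add]
  simp only [sum_congrWords_Y]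
  simp [wtX]

/-- This is the pullback of `dz/(z - ζ_r^i)`: the `n`-th roots of `ζ_r^i` are the `ζ_{rn}^(i + r
k)`. -/
theorem sum_logForm_Y {r n : ℕ} [NeZero r] [NeZero n] (i : Fin r) {z : ℂ}
    (hz : z ∈ curveV (r * n)) :
    ∑ k : Fin n, logForm (Letter.Y (n := r * n) ⟨i + r * k, add_mul_lt_mul i.isLt k.isLt⟩) z =
      logForm (Letter.Y i) (z ^ n) * (n * z ^ (n - 1)) := by
  have h1 : (zetaRoot (r * n) ^ (i : ℕ)) ^ n = zetaRoot r ^ (i : ℕ) := by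
    rw [← pow_mul, mul_comm (i : ℕ), pow_mul, zetaRoot_mul_pow_right]
  have h2 : z ^ n ≠ (zetaRoot (r * n) ^ (i : ℕ)) ^ n := by
    rw [h1]
    intro h
    apply hz.2
    rw [mul_comm, pow_mul, h, ← pow_mul, mul_comm, pow_mul, zetaRoot_pow_self, one_pow]
  have h3 := sum_one_div_sub_mul_zetaRoot_pow n h2
  rw [h1] at h3
  simp only [logForm]
  rw [one_div_mul_eq_div, ← h3]
  refine Finset.sum_congr rfl fun k _ => ?_
  rw [pow_add, pow_mul (zetaRoot (r * n)) r, zetaRoot_mul_pow_left]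

theorem IsHorizontal.pushSeries {r n : ℕ} [NeZero r] [NeZero n] {γ : ℝ → ℂ} {a b : ℝ}
    {F : ℝ → NCSeries (r * n)} (hF : IsHorizontal (r * n) γ a b F)
    (hγ : ∀ t ∈ Ioo a b, γ t ∈ curveV (r * n))
    (hd : ∃ S : Set ℝ, S.Countable ∧ ∀ t ∈ Ioo a b \ S, DifferentiableAt ℝ γ t) :
    IsHorizontal r (fun t => γ t ^ n) a b (fun t => pushSeries r (r * n) n (F t)) := by
  obtain ⟨S, hS, hS'⟩ := hF.hasDerivAt
  obtain ⟨T, hT, hT'⟩ := hd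
  refine ⟨fun w => ?_, fun t ht => ?_, S ∪ T, hS.union hT, fun t ht w x => ?_⟩
  · exact continuousOn_const.mul (continuousOn_finsetSum _ fun u _ => hF.continuousOn u)
  · rw [pushSeries_nil, pushSeries_nil, hF.nil t ht]
  · have h1 := hS' t ⟨ht.1, fun h => ht.2 (Or.inl h)⟩
    have h2 := (hT' t ⟨ht.1, fun h => ht.2 (Or.inr h)⟩).hasDerivAt.fun_pow n
    rw [h2.deriv]
    have hne := (hγ t ht.1).1
    cases x with
    | X =>
      simp only [pushSeries_append_X]
      refine ((HasDerivAt.fun_sum fun u (_ : u ∈ congrWords r (r * n) w) =>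
        h1 u Letter.X).const_mul _).congr_deriv ?_
      have h3 : γ t ^ n = γ t ^ (n - 1) * γ t := (pow_sub_one_mul (NeZero.ne n) _).symm
      rw [← Finset.sum_mul, _root_.pushSeries, logForm, logForm, h3]
      field_simp
    | Y i =>
      simp only [pushSeries_append_Y]
      refine ((HasDerivAt.fun_sum fun u (_ : u ∈ congrWords r (r * n) w) =>
        HasDerivAt.fun_sum fun k (_ : k ∈ (Finset.univ : Finset (Fin n))) =>
          h1 u (Letter.Y ⟨i + r * k, add_mul_lt_mul i.isLt k.isLt⟩)).const_mul _).congr_deriv ?_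
      simp only [← Finset.mul_sum, ← Finset.sum_mul, sum_logForm_Y i (hγ t ht.1)]
      rw [_root_.pushSeries]
      ring

theorem IsTangentialPath.pow {r n : ℕ} [NeZero n] {γ : ℝ → ℂ} {z : ℂ}
    (h : IsTangentialPath (r * n) γ z) : IsTangentialPath r (fun t => γ t ^ n) (z ^ n) where
  continuousOn := h.continuousOn.pow n
  map_zero := by simp [h.map_zero, NeZero.ne n]
  map_one := by rw [h.map_one]
  mem_curve t ht := by
    have := h.mem_curve t ht
    refine ⟨pow_ne_zero n this.1, ?_⟩
    rw [← pow_mul, mul_comm]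
    exact this.2
  direction := by
    have := h.direction.pow n
    simpa [div_pow] using this
  piecewise := by
    obtain ⟨S, hS⟩ := h.piecewise
    exact ⟨S, fun a b ha hab hb hSab => (hS a b ha hab hb hSab).pow n⟩

theorem IsTangentialPath.exists_differentiableAt {n : ℕ} {γ : ℝ → ℂ} {z : ℂ}
    (h : IsTangentialPath n γ z) {a b : ℝ} (ha : 0 ≤ a) (hb : b ≤ 1) :
    ∃ S : Set ℝ, S.Countable ∧ ∀ t ∈ Ioo a b \ S, DifferentiableAt ℝ γ t := by
  obtain ⟨S, hS⟩ := h.exists_isBreakSet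
  exact ⟨S, S.countable_toSet, fun t ht =>
    (hS.contDiffAt ⟨ha.trans_lt ht.1.1, ht.1.2.trans_le hb⟩ ht.2).differentiableAt (by simp)⟩

theorem IsTangentialPath.pushSeries_Lambda {r n : ℕ} [NeZero r] [NeZero n] {γ : ℝ → ℂ} {z : ℂ}
    (h : IsTangentialPath (r * n) γ z) {s : ℝ} (hs : 0 < s) (hs1 : s ≤ 1) :
    pushSeries r (r * n) n (Lambda (r * n) γ s 1) = Lambda r (fun t => γ t ^ n) s 1 := by
  refine ((h.isHorizontal_Lambda hs hs1).pushSeries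
    (fun t ht => h.mem_curve t ⟨hs.trans ht.1, ht.2.le⟩)
    (h.exists_differentiableAt hs.le le_rfl)).eq
    (h.pow.isHorizontal_Lambda hs hs1) (funext fun w => ?_) (right_mem_Icc.mpr hs1)
  by_cases hw : w = []
  · subst hw
    rw [pushSeries_nil, Lambda_nil, Lambda_nil]
  · rw [Lambda_self_of_ne_nil _ _ hw, pushSeries, Finset.sum_eq_zero, mul_zero]
    intro u hu
    refine Lambda_self_of_ne_nil _ _ fun h0 => hw ?_
    rw [← mem_congrWords.mp hu, h0, List.map_nil]

/-- The argument of `γ s` tends to `0`, so `n` times it eventually stays within the principal range.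
-/
theorem IsTangentialPath.log_pow {n m : ℕ} {γ : ℝ → ℂ} {z : ℂ} (h : IsTangentialPath m γ z) :
    ∀ᶠ s in 𝓝[>] 0, Complex.log (γ s ^ n) = n * Complex.log (γ s) := by
  have h1 := h.tendsto_arg.const_mul (n : ℝ)
  rw [mul_zero] at h1
  filter_upwards [Ioc_mem_nhdsGT one_pos,
    h1.eventually (Ioo_mem_nhds (neg_lt_zero.mpr Real.pi_pos) Real.pi_pos)] with s hs hi
  have h2 : (n * Complex.log (γ s)).im = n * (γ s).arg := by
    rw [← nsmul_eq_mul, Complex.smul_im, Complex.log_im, nsmul_eq_mul]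
  rw [← Complex.exp_log (h.mem_curve s hs).1, ← Complex.exp_nat_mul, Complex.log_exp,
    Complex.exp_log (h.mem_curve s hs).1]
  · rw [h2]; exact hi.1
  · rw [h2]; exact hi.2.le

theorem IsTangentialPath.pushSeries_regLambda {r n : ℕ} [NeZero r] [NeZero n] {γ : ℝ → ℂ} {z : ℂ}
    (h : IsTangentialPath (r * n) γ z) :
    ∀ᶠ s in 𝓝[>] 0,
      pushSeries r (r * n) n (regLambda (r * n) γ s) = regLambda r (fun t => γ t ^ n) s := by
  filter_upwards [Ioc_mem_nhdsGT one_pos, h.log_pow (n := n)] with s hs hlog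
  rw [regLambda, regLambda, pushSeries_mul, pushSeries_expX, h.pushSeries_Lambda hs.1 hs.2, hlog]

theorem IsTangentialPath.liWord_pow {r n : ℕ} [NeZero r] [NeZero n] {γ : ℝ → ℂ} {z : ℂ}
    (h : IsTangentialPath (r * n) γ z) (w : Word r) :
    LiWord r (fun t => γ t ^ n) w =
      (n : ℂ) ^ wtX w * ∑ u ∈ congrWords r (r * n) w, LiWord (r * n) γ u := by
  refine Tendsto.limUnder_eq (((tendsto_finsetSum _ fun u _ => h.liConverges u).const_mul
    ((n : ℂ) ^ wtX w)).congr' ?_)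
  filter_upwards [h.pushSeries_regLambda] with s hs
  rw [← hs, pushSeries]

/-! ### Rotations -/

/-- The map of letters `X ↦ X`, `Y_{0,1} ↦ Y_{i,n}`. -/
def Letter.fromOne {n : ℕ} (i : Fin n) : Letter 1 → Letter n
  | .X => .X
  | .Y _ => .Y i

theorem logForm_fromOne {n : ℕ} (i : Fin n) (a : Letter 1) {ζ : ℂ}
    (hζ : ζ * zetaRoot n ^ (i : ℕ) = 1) (z : ℂ) :
    logForm a (ζ * z) * ζ = logForm (a.fromOne i) z := by
  have h0 : ζ ≠ 0 := left_ne_zero_of_mul_eq_one hζ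
  cases a with
  | X => simp only [logForm, Letter.fromOne]; rw [one_div, mul_inv, mul_comm ζ⁻¹, mul_assoc,
      inv_mul_cancel₀ h0, mul_one, one_div]
  | Y j =>
    have hj : (j : ℕ) = 0 := by omega
    simp only [logForm, Letter.fromOne]
    rw [hj, pow_zero, show ζ * z - 1 = ζ * (z - zetaRoot n ^ (i : ℕ)) by rw [mul_sub, hζ],
      one_div, mul_inv, mul_comm ζ⁻¹, mul_assoc, inv_mul_cancel₀ h0, mul_one, one_div]

/-- Beyond `δ` the rotation pulls the form of `Y_{0,1}` back to that of `Y_{i,n}` and fixes `dz/z`,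
so both sides solve one equation with the same value at `δ`. -/
theorem Lambda_rotate {n : ℕ} {γ γ' : ℝ → ℂ} {z z' : ℂ} (h : IsTangentialPath n γ z)
    (h' : IsTangentialPath 1 γ' z') {i : Fin n} {ζ : ℂ} (hζ : ζ * zetaRoot n ^ (i : ℕ) = 1)
    {δ : ℝ} (hδ : 0 < δ) (hδ1 : δ ≤ 1) (hγ : ∀ t ∈ Ioi δ, γ' t = ζ * γ t) (w : Word 1) :
    Lambda 1 γ' δ 1 w = Lambda n γ δ 1 (w.map (Letter.fromOne i)) := by
  have hΛ := h.isHorizontal_Lambda hδ hδ1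
  have h1 : IsHorizontal 1 γ' δ 1
      (fun t w => Lambda n γ δ t (w.map (Letter.fromOne i))) := by
    obtain ⟨S, hS, hS'⟩ := hΛ.hasDerivAt
    obtain ⟨T, hT, hT'⟩ := h.exists_differentiableAt hδ.le le_rfl
    refine ⟨fun w => hΛ.continuousOn _, fun t _ => rfl, S ∪ T, hS.union hT, fun t ht w x => ?_⟩
    have h2 : HasDerivAt γ' (ζ * deriv γ t) t := by
      refine ((hT' t ⟨ht.1, fun h => ht.2 (Or.inr h)⟩).hasDerivAt.const_mul ζ).congr_of_eventuallyEq
        ?_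
      filter_upwards [Ioi_mem_nhds ht.1.1] with u hu
      exact hγ u hu
    have h3 := hS' t ⟨ht.1, fun h => ht.2 (Or.inl h)⟩ (w.map (Letter.fromOne i)) (x.fromOne i)
    rw [h2.deriv, hγ t ht.1.1, ← mul_assoc (logForm _ _), logForm_fromOne i x hζ]
    simpa only [List.map_append, List.map_cons, List.map_nil] using h3
  refine congrFun ((h'.isHorizontal_Lambda hδ hδ1).eq h1 (funext fun w => ?_)
    (right_mem_Icc.mpr hδ1)) w
  by_cases hw : w = []
  · subst hw; rfl
  · rw [Lambda_self_of_ne_nil _ _ hw, Lambda_self_of_ne_nil]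
    simpa using hw

/-- The two sides have the same derivative, so they differ by a constant on the half-plane `Re l <
0`. The vanishing of both coefficients in `exp (l X)` makes both sides tend to `0` along the
negative real axis, so the constant is `0`. -/
theorem asympSol_rotate_append {n : ℕ} {i : Fin n} {c : ℂ} (hc : c.re = 0)
    (hζ : Complex.exp c * zetaRoot n ^ (i : ℕ) = 1) {w : Word 1} {x : Letter 1}
    (ih : ∀ l : ℂ, l.re < 0 → asympSol 1 (l + c) w = asympSol n l (w.map (Letter.fromOne i)))
    (h1 : ∀ l, NCSeries.expX 1 l (w ++ [x]) = 0)
    (h2 : ∀ l, NCSeries.expX n l ((w ++ [x]).map (Letter.fromOne i)) = 0) {l : ℂ}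
    (hl : l.re < 0) :
    asympSol 1 (l + c) (w ++ [x]) = asympSol n l ((w ++ [x]).map (Letter.fromOne i)) := by
  set f : ℂ → ℂ := fun l => asympSol 1 (l + c) (w ++ [x]) -
    asympSol n l ((w ++ [x]).map (Letter.fromOne i)) with hf
  have hd : ∀ l ∈ {l : ℂ | l.re < 0}, HasDerivAt f 0 l := by
    intro l hl
    have hlc : (l + c).re < 0 := by rw [Complex.add_re, hc, add_zero]; exact hl
    have h3 := (hasDerivAt_asympSol w x hlc).comp_add_const l c
    have h4 := hasDerivAt_asympSol (w.map (Letter.fromOne i)) (x.fromOne i) hl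
    have h5 := h3.sub h4
    rw [ih l hl, Complex.exp_add, mul_comm (Complex.exp l), ← mul_assoc (logForm x _),
      logForm_fromOne i x hζ, sub_self] at h5
    simp only [hf, List.map_append, List.map_cons, List.map_nil]
    exact h5
  have hconst : ∀ x : ℝ, 0 < x → f (-(x : ℂ)) = f l := fun x hx =>
    (isOpen_lt Complex.continuous_re continuous_const).is_const_of_deriv_eq_zero
      (convex_halfSpace_re_lt 0).isPreconnected
      (fun l hl => (hd l hl).differentiableAt.differentiableWithinAt) (fun l hl => (hd l hl).deriv)
      (show (-(x : ℂ)).re < 0 by simpa using hx) hl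
  have hlim : Tendsto (fun x : ℝ => f (-(x : ℂ))) atTop (𝓝 0) := by
    have h3 := tendsto_asympSol_sub_expX (u := atTop) (l := fun x : ℝ => -(x : ℂ) + c) (c := c.im)
      (w ++ [x]) (by simpa [hc] using tendsto_neg_atTop_atBot) (by simp)
      (hasPolyGrowth_const 1)
    have h4 := tendsto_asympSol_sub_expX (u := atTop) (l := fun x : ℝ => -(x : ℂ)) (c := 0)
      ((w ++ [x]).map (Letter.fromOne i)) (by simpa using tendsto_neg_atTop_atBot)
      (by simp) (hasPolyGrowth_const 1)
    simpa only [h1, h2, sub_zero, mul_one] using h3.sub h4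
  have : f l = 0 := tendsto_nhds_unique
    (tendsto_const_nhds.congr' ((eventually_gt_atTop 0).mono fun x hx => (hconst x hx).symm)) hlim
  exact sub_eq_zero.mp this

theorem expX_Y_cons {n : ℕ} (l : ℂ) (i : Fin n) (w : Word n) :
    NCSeries.expX n l (Letter.Y i :: w) = 0 := by
  rw [NCSeries.expX, if_neg]
  simp [List.replicate_succ]

/-- The leading `Y` is essential: at the word `X` the left side would be `l + c` and the right side
`l`. -/
theorem asympSol_rotate {n : ℕ} {i : Fin n} {c : ℂ} (hc : c.re = 0)
    (hζ : Complex.exp c * zetaRoot n ^ (i : ℕ) = 1) (w : Word 1) {l : ℂ} (hl : l.re < 0) :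
    asympSol 1 (l + c) (Letter.Y 0 :: w) =
      asympSol n l ((Letter.Y 0 :: w).map (Letter.fromOne i)) := by
  induction w using List.reverseRecOn generalizing l with
  | nil =>
    refine asympSol_rotate_append (w := []) hc hζ (fun l _ => ?_) (fun l => expX_Y_cons l 0 [])
      (fun l => expX_Y_cons l i []) hl
    rw [List.map_nil, asympSol_nil, asympSol_nil]
  | append_singleton w x ih =>
    exact asympSol_rotate_append (w := Letter.Y 0 :: w) hc hζ (fun l hl => ih hl)
      (fun l => expX_Y_cons l _ _) (fun l => expX_Y_cons l _ _) hl

/-! ### The path composed of an arc and a rotated path -/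

section Arc

variable {n : ℕ} {γ : ℝ → ℂ} {z : ℂ} {δ α : ℝ}

theorem arcThenRotate_of_ge (hδ : 0 < δ) {t : ℝ} (ht : δ ≤ t) :
    arcThenRotate α δ γ t = Complex.exp (Complex.I * α) * γ t := by
  rw [arcThenRotate, min_eq_left ((one_le_div hδ).mpr ht), mul_one]

theorem arcThenRotate_of_le (hδ : 0 < δ) {t : ℝ} (ht : t ≤ δ) :
    arcThenRotate α δ γ t = Complex.exp (Complex.I * ((α * (t / δ) : ℝ) : ℂ)) * γ t := by
  rw [arcThenRotate, min_eq_right ((div_le_one hδ).mpr ht)]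

theorem norm_arcThenRotate (t : ℝ) : ‖arcThenRotate α δ γ t‖ = ‖γ t‖ := by
  rw [arcThenRotate, norm_mul, mul_comm Complex.I, Complex.norm_exp_ofReal_mul_I, one_mul]

theorem continuous_arc : Continuous
    (fun t : ℝ => Complex.I * ((α * min 1 (t / δ) : ℝ) : ℂ)) := by
  fun_prop

theorem tendsto_arc_zero : Tendsto (fun t : ℝ => Complex.I * ((α * min 1 (t / δ) : ℝ) : ℂ))
    (𝓝[>] 0) (𝓝 0) := by
  have := (continuous_arc (α := α) (δ := δ)).tendsto 0
  simp only [zero_div, min_eq_right zero_le_one, mul_zero, Complex.ofReal_zero] at this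
  exact this.mono_left nhdsWithin_le_nhds

/-- Up to `δ` the norm is less than `1`, so the arc misses the point `1`; after `δ` the path is `ζ
γ`, which misses `1` because `γ` avoids `μ_n`. The time `δ` becomes an additional break point. -/
theorem IsTangentialPath.arcThenRotate (h : IsTangentialPath n γ z) (hδ : 0 < δ) (hδ1 : δ ≤ 1)
    (hlt : ∀ t ∈ Ioc 0 δ, ‖γ t‖ < 1) (hα : Complex.exp (Complex.I * α) ^ n = 1) :
    IsTangentialPath 1 (arcThenRotate α δ γ) (Complex.exp (Complex.I * α) * z) where
  continuousOn := continuous_arc.cexp.continuousOn.mul h.continuousOn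
  map_zero := by simp [_root_.arcThenRotate, h.map_zero]
  map_one := by rw [arcThenRotate_of_ge hδ hδ1, h.map_one]
  mem_curve t ht := by
    have hm := h.mem_curve t ht
    refine ⟨mul_ne_zero (Complex.exp_ne_zero _) hm.1, ?_⟩
    rw [pow_one]
    rcases le_total t δ with htδ | htδ
    · intro h1
      have h2 := hlt t ⟨ht.1, htδ⟩
      rw [← norm_arcThenRotate (α := α) (δ := δ), h1, norm_one] at h2
      exact lt_irrefl _ h2
    · rw [arcThenRotate_of_ge hδ htδ]
      intro h1
      apply hm.2
      have h2 := congrArg (· ^ n) h1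
      simpa only [mul_pow, hα, one_mul, one_pow] using h2
  direction := by
    have h1 := (tendsto_arc_zero (α := α) (δ := δ)).cexp.mul h.direction
    rw [Complex.exp_zero, one_mul] at h1
    refine h1.congr fun t => ?_
    rw [norm_arcThenRotate, mul_div_assoc', _root_.arcThenRotate]
  piecewise := by
    classical
    obtain ⟨S, hS⟩ := h.piecewise
    refine ⟨insert δ S, fun a b ha hab hb hSab => ?_⟩
    have hC := hS a b ha hab hb fun t ht hmem => hSab t ht (Finset.mem_insert_of_mem hmem)
    have hδab : b ≤ δ ∨ δ ≤ a := by
      by_contra hcon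
      push Not at hcon
      exact hSab δ ⟨hcon.2, hcon.1⟩ (Finset.mem_insert_self δ S)
    rcases hδab with hbδ | hδa
    · have h1 : ContDiff ℝ 1 (fun t : ℝ => Complex.exp (Complex.I * ((α * (t / δ) : ℝ) : ℂ))) := by
        refine ContDiff.cexp (contDiff_const.mul (Complex.ofRealCLM.contDiff.comp ?_))
        exact contDiff_const.mul (contDiff_id.div_const δ)
      exact (h1.contDiffOn.mul hC).congr fun t ht => arcThenRotate_of_le hδ (ht.2.trans hbδ)
    · exact (contDiffOn_const.mul hC).congr fun t ht => arcThenRotate_of_ge hδ (hδa.trans ht.1)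

/-- The angle of the arc starts at `0`, so the lift remains principal near the base point; at `δ` it
has gained exactly `I * α`. -/
theorem IsLogLift.arcThenRotate {l : ℝ → ℂ} (hl : IsLogLift γ δ l) (hδ : 0 < δ) :
    IsLogLift (arcThenRotate α δ γ) δ
      (fun t => l t + Complex.I * ((α * min 1 (t / δ) : ℝ) : ℂ)) where
  continuousOn := hl.continuousOn.add continuous_arc.continuousOn
  exp_eq t ht := by rw [Complex.exp_add, hl.exp_eq t ht, mul_comm, _root_.arcThenRotate]
  tendsto_im := by
    have h1 := (Complex.continuous_im.tendsto _).comp (tendsto_arc_zero (α := α) (δ := δ))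
    simpa using hl.tendsto_im.add h1
  differentiableAt := by
    obtain ⟨S, hS, hS'⟩ := hl.differentiableAt
    refine ⟨S, hS, fun t ht => (hS' t ht).add ?_⟩
    have h1 : DifferentiableAt ℝ (fun t : ℝ => Complex.I * ((α * (t / δ) : ℝ) : ℂ)) t := by
      refine DifferentiableAt.const_mul (Complex.ofRealCLM.differentiableAt.comp t ?_) _
      exact (differentiableAt_id.div_const δ).const_mul α
    refine h1.congr_of_eventuallyEq ?_
    filter_upwards [Iio_mem_nhds ht.1.2] with u hu
    rw [min_eq_right ((div_le_one hδ).mpr (le_of_lt hu))]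

theorem IsTangentialPath.liWord_arcThenRotate (h : IsTangentialPath n γ z) (hδ : 0 < δ)
    (hδ1 : δ ≤ 1) (hlt : ∀ t ∈ Ioc 0 δ, ‖γ t‖ < 1) {i : Fin n}
    (hα : Complex.exp (Complex.I * α) * zetaRoot n ^ (i : ℕ) = 1)
    (hα' : Complex.exp (Complex.I * α) ^ n = 1) (w : Word 1) :
    LiWord 1 (_root_.arcThenRotate α δ γ) (Letter.Y 0 :: w) =
      LiWord n γ ((Letter.Y 0 :: w).map (Letter.fromOne i)) := by
  obtain ⟨l, hl⟩ := h.exists_isLogLift hδ hδ1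
  have h' := h.arcThenRotate hδ hδ1 hlt hα'
  rw [hl.liWord_eq h hδ hδ1 hlt, (hl.arcThenRotate hδ).liWord_eq h' hδ hδ1
    (fun t ht => by rw [norm_arcThenRotate]; exact hlt t ht), NCSeries.mul, NCSeries.mul,
    List.length_map]
  refine Finset.sum_congr rfl fun k _ => ?_
  rw [← List.map_take, ← List.map_drop, div_self hδ.ne', min_self, mul_one]
  congr 1
  -- A nonempty prefix begins with `Y`, where the shift by `I * α` is harmless; the empty prefix has
  -- coefficient `1` on both sides.
  · cases k with
    | zero => rw [List.take_zero, List.map_nil, asympSol_nil, asympSol_nil]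
    | succ k =>
      rw [List.take_succ_cons]
      exact asympSol_rotate (by simp) hα _ (hl.re_neg hlt ⟨hδ, le_rfl⟩)
  · exact Lambda_rotate h h' hα hδ hδ1 (fun t ht => arcThenRotate_of_ge hδ (le_of_lt ht)) _

end Arc

/-! ### The Kubert identity -/

theorem IsTangentialPath.liWord_pow_one {n : ℕ} [NeZero n] {γ : ℝ → ℂ} {z : ℂ}
    (h : IsTangentialPath n γ z) (w : Word 1) :
    LiConverges 1 (fun t => γ t ^ n) w ∧ LiWord 1 (fun t => γ t ^ n) w =
      (n : ℂ) ^ wtX w * ∑ u ∈ congrWords 1 n w, LiWord n γ u := by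
  -- The case `r = 1` speaks of level `1 * n`; a variable level lets the equality be substituted in
  -- the dependent types.
  have key : ∀ m : ℕ, 1 * n = m → IsTangentialPath m γ z →
      LiConverges 1 (fun t => γ t ^ n) w ∧ LiWord 1 (fun t => γ t ^ n) w =
        (n : ℂ) ^ wtX w * ∑ u ∈ congrWords 1 m w, LiWord m γ u := by
    rintro m rfl h
    exact ⟨h.pow.liConverges w, h.liWord_pow w⟩
  exact key n (one_mul n) h

theorem sum_congrWords_polylogWord {n : ℕ} (k : ℕ) (f : Word n → ℂ) :
    ∑ u ∈ congrWords 1 n (polylogWord k), f u =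
      ∑ i : Fin n, f ((polylogWord k).map (Letter.fromOne i)) := by
  have hX : ∀ (i : Fin n) (j : ℕ), (List.replicate j Letter.X).map (Letter.fromOne i) =
    List.replicate j Letter.X := fun i j => by rw [List.map_replicate]; rfl
  symm
  refine Finset.sum_nbij (fun i => (polylogWord k).map (Letter.fromOne i))
    (fun i _ => ?_) (fun i _ i' _ h => ?_) (fun u hu => ?_) (fun _ _ => rfl)
  · rw [mem_congrWords, polylogWord, List.map_cons, hX, List.map_cons, List.map_replicate]
    simp [Letter.modulo, Letter.fromOne, Nat.mod_one]
  · simpa [polylogWord, Letter.fromOne] using h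
  · rw [Finset.mem_coe, mem_congrWords, polylogWord, List.map_eq_cons_iff] at hu
    obtain ⟨a, v, rfl, ha, hv⟩ := hu
    cases a with
    | X => simp [Letter.modulo] at ha
    | Y i =>
      refine ⟨i, Finset.mem_coe.mpr (Finset.mem_univ _), ?_⟩
      simp only [polylogWord, List.map_cons, hX]
      congr 1
      rw [eq_comm, List.eq_replicate_iff]
      rw [List.eq_replicate_iff, List.length_map] at hv
      refine ⟨hv.1, fun b hb => ?_⟩
      have := hv.2 _ (List.mem_map_of_mem hb)
      cases b with
      | X => rfl
      | Y j => simp [Letter.modulo] at this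

theorem wtX_polylogWord (k : ℕ) : wtX (polylogWord k) = k - 1 := by
  simp [wtX, polylogWord]

theorem exp_I_mul_eq_zetaRoot_pow (n s : ℕ) :
    Complex.exp (Complex.I * ((2 * Real.pi * s / n : ℝ) : ℂ)) = zetaRoot n ^ s := by
  rw [zetaRoot, ← Complex.exp_nat_mul]
  congr 1
  push_cast
  ring

theorem zetaRoot_pow_mul_pow_neg {n : ℕ} [NeZero n] (i : Fin n) :
    zetaRoot n ^ (i : ℕ) * zetaRoot n ^ ((-i : Fin n) : ℕ) = 1 := by
  rw [Fin.val_neg', ← pow_eq_pow_mod _ (zetaRoot_pow_self n), ← pow_add,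
    Nat.add_sub_cancel' i.isLt.le, zetaRoot_pow_self]

theorem mainTheorem1 (n : ℕ) [NeZero n] :
    (∀ (r : ℕ) [NeZero r] (z : ℂ) (γ : ℝ → ℂ), IsTangentialPath (r * n) γ z →
      IsTangentialPath r (fun t => γ t ^ n) (z ^ n) ∧
      (∀ u : Word (r * n), LiConverges (r * n) γ u) ∧
      ∀ w : Word r,
        LiConverges r (fun t => γ t ^ n) w ∧
        LiWord r (fun t => γ t ^ n) w =
          (n : ℂ) ^ wtX w * ∑ u ∈ congrWords r (r * n) w, LiWord (r * n) γ u) ∧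
    (∀ (z : ℂ) (γ : ℝ → ℂ), IsTangentialPath n γ z →
      ∀ δ : ℝ, 0 < δ → δ ≤ 1 → (∀ t ∈ Set.Ioc 0 δ, ‖γ t‖ < 1) →
      (∀ s < n,
        IsTangentialPath 1 (arcThenRotate (2 * Real.pi * s / n) δ γ) (zetaRoot n ^ s * z)) ∧
      ∀ k : ℕ, 1 ≤ k →
        LiConverges 1 (fun t => γ t ^ n) (polylogWord k) ∧
        (∀ s < n, LiConverges 1 (arcThenRotate (2 * Real.pi * s / n) δ γ) (polylogWord k)) ∧
        polylogAlong k (fun t => γ t ^ n) =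
          (n : ℂ) ^ (k - 1) *
            ∑ s ∈ Finset.range n, polylogAlong k (arcThenRotate (2 * Real.pi * s / n) δ γ)) := by
  refine ⟨fun r _ z γ h => ⟨h.pow, h.liConverges, fun w => ⟨h.pow.liConverges w, h.liWord_pow w⟩⟩,
    fun z γ h δ hδ hδ1 hlt => ?_⟩
  have hroot : ∀ s : ℕ, Complex.exp (Complex.I * ((2 * Real.pi * s / n : ℝ) : ℂ)) ^ n = 1 := by
    intro s
    rw [exp_I_mul_eq_zetaRoot_pow, ← pow_mul, mul_comm, pow_mul, zetaRoot_pow_self, one_pow]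
  have hpath : ∀ s : ℕ,
      IsTangentialPath 1 (arcThenRotate (2 * Real.pi * s / n) δ γ) (zetaRoot n ^ s * z) := by
    intro s
    rw [← exp_I_mul_eq_zetaRoot_pow]
    exact h.arcThenRotate hδ hδ1 hlt (hroot s)
  refine ⟨fun s _ => hpath s, fun k _ => ⟨(h.liWord_pow_one _).1,
    fun s _ => (hpath s).liConverges _, ?_⟩⟩
  simp only [polylogAlong]
  -- The index `i` that belongs to the rotation by `ζ_n^s` satisfies `ζ_n^s ζ_n^i = 1`, that is `i =
  -- -s` in `Fin n`; hence the reindexing by negation.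
  rw [(h.liWord_pow_one _).2, wtX_polylogWord, sum_congrWords_polylogWord, Finset.sum_neg_distrib,
    mul_neg, ← Fin.sum_univ_eq_sum_range
      (fun s => LiWord 1 (arcThenRotate (2 * Real.pi * s / n) δ γ) (polylogWord k)) n,
    ← Equiv.sum_comp (Equiv.neg (Fin n))]
  congr 2
  refine Finset.sum_congr rfl fun i _ => ?_
  refine (h.liWord_arcThenRotate hδ hδ1 hlt ?_ (hroot i) _).symm
  rw [exp_I_mul_eq_zetaRoot_pow, Equiv.neg_apply, zetaRoot_pow_mul_pow_neg]
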